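/- Small deformations of a ring behave elastically. For $n\ge 2$ let $R=\dfrac{1}{2n\sin(\pi/n)}=\dfrac1{2\pi}+O(n^{-2})$, let $\varepsilon>0$, let $w,u$ be smooth $2\pi$-periodic real functions (circumferential and radial displacement), and consider the deformed ring $$\mathbf r(s)=R\,[1-\varepsilon u(2\pi s)]\,\bigl(\cos(2\pi s+\varepsilon w(2\pi s)),\ \sin(2\pi s+\varepsilon w(2\pi s))\bigr)\in\mathbb R^2 .$$ Define $$\mathcal E_{\rm loc}=\int_0^1\|\mathbf r''(s)\|^2ds,\qquad \mathcal E_{\rm tot}=\frac{\zeta(3)}4\,\mathcal E_{\rm loc}+\frac12\,\mathcal E_{\rm nonloc},$$ $$\mathcal E_{\rm nonloc}=\int_0^1\ \mathrm{f.p.}\!\!\int_0^1\left(-\frac{3\,[(\mathbf r(s)-\mathbf r(\eta))\cdot\mathbf r'(\eta)]\,[(\mathbf r(s)-\mathbf r(\eta))\cdot\mathbf r'(s)]}{\|\mathbf r(s)-\mathbf r(\eta)\|^5}+\frac{\mathbf r'(\eta)\cdot\mathbf r'(s)}{\|\mathbf r(s)-\mathbf r(\eta)\|^3}\right)d\eta\,ds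 ,$$ where f.p. denotes the Hadamard finite part: remove $(s-\delta,s+\delta)$ from $[0,1]$ and discard the terms in $\delta^{-2}$, $\delta^{-1}$ and $\log\delta$ as $\delta\to0^+$. For every $K$ there are $C$, $\varepsilon_0>0$ and $n_0$ such that the following holds for all $n\ge n_0$, all $0<\varepsilon\le\varepsilon_0$ and all smooth $2\pi$-periodic $w,u$ with $|w^{(j)}|\le K$ for $j\le7$ and $|u^{(j)}|\le K$ for $j\le 6$. Suppose that the deformation is inextensible, $\|\mathbf r'(s)\|=1$, up to an error that is bounded, together with its derivatives of order at most $5$, by $K(\varepsilon^3+n^{-2})$. Then the finite part exists for every $s\in(0,1)$, it is an integrable function of $s$, and, with $I[w]=\int_0^{2\pi}\bigl(w'^2-2w''^2+w'''^2\bigr)d\theta$, each of the following holds with an error of absolute value at most $C(\varepsilon^3+n^{-2})$: $$\mathcal E_{\rm loc}=4\pi^2+2\pi\varepsilon^2 I[w]+O(\varepsilon^3,n^{-2}),\qquad \mathcal E_{\rm nonloc}=\frac{\pi^2}3+\frac{\pi\varepsilon^2}6\,I[w]+O(\varepsilon^3,n^{-2}),$$ $$\mathcal E_{\rm nonloc}=\frac1{12}\,\mathcal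 E_{\rm loc}+O(\varepsilon^3,n^{-2}),\qquad \mathcal E_{\rm tot}=\Bigl(\frac{\zeta(3)}4+\frac1{24}\Bigr)\mathcal E_{\rm loc}+O(\varepsilon^3,n^{-2}).$$ -/

import Mathlib

open Real Set Filter Topology MeasureTheory
open scoped ContDiff

/-- `IsFinitePart f a b c v`: the Hadamard finite part of `∫ x in [a, b], f x`, where `f` has a
singularity of order at most three at `c`, exists and equals `v`. The interval `(c - δ, c + δ)` is
removed, and the terms in `δ⁻²`, `δ⁻¹` and `log δ` that diverge as `δ → 0⁺` are discarded. -/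
def IsFinitePart (f : ℝ → ℝ) (a b c v : ℝ) : Prop :=
  (∀ δ : ℝ, 0 < δ → IntegrableOn f (Icc a b \ Ioo (c - δ) (c + δ))) ∧
  ∃ A₂ A₁ A₀ : ℝ,
    Tendsto (fun δ : ℝ => (∫ x in Icc a b \ Ioo (c - δ) (c + δ), f x)
      - (A₂ * (δ ^ 2)⁻¹ + A₁ * δ⁻¹ + A₀ * Real.log δ)) (𝓝[>] 0) (𝓝 v)

/-- If a combination of `δ⁻²`, `δ⁻¹`, `log δ` has a limit as `δ → 0⁺`, the limit is zero. -/
theorem divergent_limit_eq_zero {A₂ A₁ A₀ l : ℝ}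
    (h : Tendsto (fun δ : ℝ => A₂ * (δ ^ 2)⁻¹ + A₁ * δ⁻¹ + A₀ * Real.log δ) (𝓝[>] 0) (𝓝 l)) :
    l = 0 := by
  have hid : Tendsto (fun δ : ℝ => δ) (𝓝[>] 0) (𝓝 0) := tendsto_nhdsWithin_of_tendsto_nhds tendsto_id
  have hlog1 : Tendsto (fun δ : ℝ => Real.log δ * δ) (𝓝[>] 0) (𝓝 0) := by
    simpa using tendsto_log_mul_rpow_nhdsGT_zero (r := 1) one_pos
  have hpos : ∀ᶠ δ : ℝ in 𝓝[>] 0, 0 < δ := eventually_mem_nhdsWithin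
  have hA₂ : A₂ = 0 := by
    have h1 := (hid.mul hid).mul h
    have h2 : Tendsto (fun δ : ℝ => A₂ + A₁ * δ + A₀ * (Real.log δ * δ) * δ) (𝓝[>] 0) (𝓝 A₂) := by
      simpa using ((tendsto_const_nhds (x := A₂)).add (hid.const_mul A₁)).add
        ((hlog1.const_mul A₀).mul hid)
    have h3 := tendsto_nhds_unique (h2.congr' (by
      filter_upwards [hpos] with δ hδ
      field_simp)) h1
    simpa using h3
  subst hA₂
  have hA₁ : A₁ = 0 := by
    have h1 := hid.mul h
    have h2 : Tendsto (fun δ : ℝ => A₁ + A₀ * (Real.log δ * δ)) (𝓝[>] 0) (𝓝 A₁) := by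
      simpa using (tendsto_const_nhds (x := A₁)).add (hlog1.const_mul A₀)
    have h3 := tendsto_nhds_unique (h2.congr' (by
      filter_upwards [hpos] with δ hδ
      field_simp
      ring)) h1
    simpa using h3
  subst hA₁
  have hA₀ : A₀ = 0 := by
    by_contra hne
    have h1 : Tendsto (fun δ : ℝ => A₀⁻¹ * (A₀ * Real.log δ)) (𝓝[>] 0) (𝓝 (A₀⁻¹ * l)) := by
      simpa using h.const_mul A₀⁻¹
    have h2 : Tendsto Real.log (𝓝[>] 0) (𝓝 (A₀⁻¹ * l)) :=
      h1.congr (fun δ => by field_simp)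
    exact not_tendsto_nhds_of_tendsto_atBot Real.tendsto_log_nhdsGT_zero _ h2
  subst hA₀
  have h0 : Tendsto (fun _ : ℝ => (0 : ℝ)) (𝓝[>] 0) (𝓝 l) := by simpa using h
  exact (tendsto_nhds_unique h0 tendsto_const_nhds)

/-- The finite part is unique. -/
theorem IsFinitePart.unique {f : ℝ → ℝ} {a b c v v' : ℝ}
    (h : IsFinitePart f a b c v) (h' : IsFinitePart f a b c v') : v = v' := by
  obtain ⟨-, A₂, A₁, A₀, h⟩ := h
  obtain ⟨-, B₂, B₁, B₀, h'⟩ := h'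
  have h3 := divergent_limit_eq_zero (A₂ := B₂ - A₂) (A₁ := B₁ - A₁) (A₀ := B₀ - A₀)
    ((h.sub h').congr (fun δ => by ring))
  linarith

open Classical in
/-- The Hadamard finite part of `∫ x in [a, b], f x`, singular at `c` (zero if it does not
exist). -/
noncomputable def finitePart (f : ℝ → ℝ) (a b c : ℝ) : ℝ :=
  if h : ∃ v, IsFinitePart f a b c v then h.choose else 0

theorem IsFinitePart.finitePart_eq {f : ℝ → ℝ} {a b c v : ℝ}
    (h : IsFinitePart f a b c v) : finitePart f a b c = v := by
  have hex : ∃ v, IsFinitePart f a b c v := ⟨v, h⟩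
  rw [finitePart, dif_pos hex]
  exact hex.choose_spec.unique h

/-- Radius of the circle through `n` equally spaced points at mutual (chord) distance `1 / n`. -/
noncomputable def ringRadius (n : ℕ) : ℝ := (n : ℝ)⁻¹ / (2 * Real.sin (π / n))

/-- The deformed ring, in the Euclidean plane `ℂ`, with circumferential displacement `ε w(θ)` and
radial displacement `ε u(θ)` (inwards), where `θ = 2 π s`. -/
noncomputable def deformedRing (n : ℕ) (ε : ℝ) (w u : ℝ → ℝ) (s : ℝ) : ℂ :=
  ((ringRadius n * (1 - ε * u (2 * π * s)) : ℝ) : ℂ) *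
    ((Real.cos (2 * π * s + ε * w (2 * π * s)) : ℂ) +
      (Real.sin (2 * π * s + ε * w (2 * π * s)) : ℂ) * Complex.I)

/-- `∫₀¹ ‖r''(s)‖² ds`. -/
noncomputable def localEnergy (r : ℝ → ℂ) : ℝ :=
  ∫ s in (0 : ℝ)..1, ‖iteratedDeriv 2 r s‖ ^ 2

/-- Interaction density at the parameters `s`, `η` of dipoles that are tangent to the curve. -/
noncomputable def dipoleDensity (r : ℝ → ℂ) (s η : ℝ) : ℝ :=
  -(3 * inner ℝ (r s - r η) (deriv r η) * inner ℝ (r s - r η) (deriv r s)) / ‖r s - r η‖ ^ 5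
    + inner ℝ (deriv r η) (deriv r s) / ‖r s - r η‖ ^ 3

/-- The integral over `s ∈ [0, 1]` of the finite part over `η ∈ [0, 1]` of the density. -/
noncomputable def nonlocalEnergy (r : ℝ → ℂ) : ℝ :=
  ∫ s in (0 : ℝ)..1, finitePart (dipoleDensity r s) 0 1 s

/-- The total deformation energy. -/
noncomputable def totalEnergy (r : ℝ → ℂ) : ℝ :=
  (riemannZeta 3).re / 4 * localEnergy r + 1 / 2 * nonlocalEnergy r

/-- `w`, `u` are smooth `2π`-periodic displacement functions, bounded by `K` together with their
derivatives up to the orders seven and six. -/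
def IsBoundedDisplacement (K : ℝ) (w u : ℝ → ℝ) : Prop :=
  ContDiff ℝ ∞ w ∧ ContDiff ℝ ∞ u ∧
  Function.Periodic w (2 * π) ∧ Function.Periodic u (2 * π) ∧
  (∀ j ≤ 7, ∀ θ, |iteratedDeriv j w θ| ≤ K) ∧
  (∀ j ≤ 6, ∀ θ, |iteratedDeriv j u θ| ≤ K)

/-- Inextensibility: `‖r'(s)‖ = 1` up to an error of size at most `τ`, the derivatives of the error
up to order five included. -/
def IsInextensibleUpTo (τ : ℝ) (r : ℝ → ℂ) : Prop :=
  ∀ j ≤ 5, ∀ s, |iteratedDeriv j (fun t => ‖deriv r t‖ - 1) s| ≤ τ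

/-- `∫₀^{2π} (w'² - 2 w''² + w'''²) dθ`. -/
noncomputable def bendingForm (w : ℝ → ℝ) : ℝ :=
  ∫ θ in (0 : ℝ)..(2 * π),
    (deriv w θ ^ 2 - 2 * iteratedDeriv 2 w θ ^ 2 + iteratedDeriv 3 w θ ^ 2)

/-! The nonlocal energy is in fact local. For fixed `s` the dipole density is the exact
`η`-derivative of `dipolePotential`, that is of (r(η) - r(s))·r'(s) / |r(η) - r(s)|³. On a closed
simple curve the boundary terms at 0 and 1 cancel, so the truncated integral depends only on the
potential at s ± δ. A Taylor expansion there leaves a δ⁻² term and a constant, the finite part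
(`isFinitePart_dipoleDensity`). With v = |r'|, the identities r'·r'' = v v' and r'·r''' = v'² + v
v'' - |r''|² turn this constant into |r''|²/12 when v ≡ 1, since 3/4 - 2/3 = 1/12. A small
perturbation of the speed changes it by a comparable amount (`nonlocalEnergy_sub_localEnergy`).

For the local energy, |r''|² and |r'|² are, up to powers of 2π and R, the polynomials `accelSq` and
`speedSq` in the derivatives of the displacements. Inextensibility gives `speedSq` = 1 and u = w'
only to leading order, with an unknown correction of order ε in u - w'. Subtracting `speedSq` from
`accelSq` makes this correction harmless (`accelSq_eq`): the remaining linear terms are exact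
derivatives, which integrate to zero over a period, and in the quadratic terms u may be replaced by
w' at cost O(ε³ + n⁻²). What survives is the density of `bendingForm` (`exists_localEnergy_bound`).
The statements on the nonlocal and total energies are then linear combinations of these two
estimates. -/

/-! ### Second-order expansions at a punctured point -/

section Expansion

variable {E : Type*} [NormedAddCommGroup E] [InnerProductSpace ℝ E]

/-- `f h = a₀ + h a₁ + h² a₂ + o(h²)` as `h → 0`, `h ≠ 0`. -/
def HasSecondOrderExpansion (f : ℝ → E) (a₀ a₁ a₂ : E) : Prop :=
  (fun h : ℝ => f h - (a₀ + h • a₁ + h ^ 2 • a₂)) =o[𝓝[≠] 0] (fun h : ℝ => h ^ 2)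

theorem tendsto_id_punctured : Tendsto (fun h : ℝ => h) (𝓝[≠] 0) (𝓝 0) :=
  tendsto_nhdsWithin_of_tendsto_nhds tendsto_id

theorem tendsto_quadratic (a₀ a₁ a₂ : E) :
    Tendsto (fun h : ℝ => a₀ + h • a₁ + h ^ 2 • a₂) (𝓝[≠] 0) (𝓝 a₀) := by
  have h : Tendsto (fun h : ℝ => a₀ + h • a₁ + h ^ 2 • a₂) (𝓝 0)
      (𝓝 (a₀ + (0 : ℝ) • a₁ + (0 : ℝ) ^ 2 • a₂)) := by
    apply Continuous.tendsto (f := fun h : ℝ => a₀ + h • a₁ + h ^ 2 • a₂)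
    fun_prop
  simpa using h.mono_left nhdsWithin_le_nhds

theorem isLittleO_inner_of_isLittleO_of_tendsto {f g : ℝ → E} {b : E}
    (hf : f =o[𝓝[≠] 0] (fun h : ℝ => h ^ 2)) (hg : Tendsto g (𝓝[≠] 0) (𝓝 b)) :
    (fun h => inner ℝ (f h) (g h)) =o[𝓝[≠] 0] (fun h : ℝ => h ^ 2) := by
  have h1 : (fun h => inner ℝ (f h) (g h)) =O[𝓝[≠] 0] (fun h => ‖f h‖ * ‖g h‖) :=
    Asymptotics.IsBigO.of_norm_le (fun h => norm_inner_le_norm _ _)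
  have h2 : (fun h => ‖f h‖ * ‖g h‖) =o[𝓝[≠] 0] (fun h : ℝ => h ^ 2 * (1 : ℝ)) :=
    hf.norm_left.mul_isBigO (hg.isBigO_one ℝ).norm_left
  simpa using h1.trans_isLittleO h2

namespace HasSecondOrderExpansion

variable {f g : ℝ → E} {a₀ a₁ a₂ b₀ b₁ b₂ : E}

theorem tendsto (hf : HasSecondOrderExpansion f a₀ a₁ a₂) : Tendsto f (𝓝[≠] 0) (𝓝 a₀) := by
  have h0 : Tendsto (fun h : ℝ => h ^ 2) (𝓝[≠] 0) (𝓝 0) := by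
    simpa using tendsto_id_punctured.pow 2
  simpa using (hf.trans_tendsto h0).add (tendsto_quadratic a₀ a₁ a₂)

theorem realInner (hf : HasSecondOrderExpansion f a₀ a₁ a₂)
    (hg : HasSecondOrderExpansion g b₀ b₁ b₂) :
    HasSecondOrderExpansion (fun h => inner ℝ (f h) (g h)) (inner ℝ a₀ b₀)
      (inner ℝ a₀ b₁ + inner ℝ a₁ b₀) (inner ℝ a₀ b₂ + inner ℝ a₁ b₁ + inner ℝ a₂ b₀) := by
  have h1 := isLittleO_inner_of_isLittleO_of_tendsto hf hg.tendsto
  have h2 := isLittleO_inner_of_isLittleO_of_tendsto hg (tendsto_quadratic a₀ a₁ a₂)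
  -- With A, B the quadratic polynomials, f·g - A·B = (f - A)·g + A·(g - B); `h3` disposes of the
  -- terms of degree three and four in A·B.
  have h3 : (fun h : ℝ => h ^ 2 * (h * (inner ℝ a₁ b₂ + inner ℝ a₂ b₁
      + h * inner ℝ a₂ b₂))) =o[𝓝[≠] 0] (fun h : ℝ => h ^ 2 * (1 : ℝ)) := by
    refine (Asymptotics.isBigO_refl _ _).mul_isLittleO ?_
    rw [Asymptotics.isLittleO_one_iff]
    simpa using tendsto_id_punctured.mul
      ((tendsto_id_punctured.mul_const (inner ℝ a₂ b₂)).const_add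
        (inner ℝ a₁ b₂ + inner ℝ a₂ b₁))
  simp only [mul_one] at h3
  refine ((h1.add h2).add h3).congr_left fun h => ?_
  rw [real_inner_comm (a₀ + h • a₁ + h ^ 2 • a₂)]
  simp only [inner_sub_left, inner_sub_right, inner_add_left, inner_add_right,
    real_inner_smul_left, real_inner_smul_right, smul_eq_mul]
  ring

end HasSecondOrderExpansion

namespace HasSecondOrderExpansion

variable {f g : ℝ → ℝ} {a₀ a₁ a₂ b₀ b₁ b₂ : ℝ}

theorem mul (hf : HasSecondOrderExpansion f a₀ a₁ a₂) (hg : HasSecondOrderExpansion g b₀ b₁ b₂) :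
    HasSecondOrderExpansion (fun h => f h * g h) (a₀ * b₀) (a₀ * b₁ + a₁ * b₀)
      (a₀ * b₂ + a₁ * b₁ + a₂ * b₀) := by
  have h := hf.realInner hg
  simp only [Real.inner_apply] at h
  exact h

/-- A factor with nonzero limit can be divided out of the error. This reduces reciprocals and square
roots to polynomial identities. -/
theorem of_mul_isLittleO {k : ℝ → ℝ} {l : ℝ} (hk : Tendsto k (𝓝[≠] 0) (𝓝 l))
    (h : (fun h : ℝ => k h * (f h - (a₀ + h * a₁ + h ^ 2 * a₂))) =o[𝓝[≠] 0]
      (fun h : ℝ => h ^ 2)) (hl : l ≠ 0) :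
    HasSecondOrderExpansion f a₀ a₁ a₂ := by
  have h1 := ((hk.inv₀ hl).isBigO_one ℝ).mul_isLittleO h
  simp only [one_mul] at h1
  refine h1.congr' ?_ EventuallyEq.rfl
  filter_upwards [hk.eventually_ne hl] with x hx
  simp only [smul_eq_mul]
  rw [inv_mul_cancel_left₀ hx]

/-- Multiplying the error f⁻¹ - B by f gives 1 - f B; `h1` and `h2` say that f B has no terms of
degree one and two. -/
theorem inv (hf : HasSecondOrderExpansion f a₀ a₁ a₂) (h0 : a₀ ≠ 0)
    (h1 : a₀ * b₁ + a₁ * a₀⁻¹ = 0) (h2 : a₀ * b₂ + a₁ * b₁ + a₂ * a₀⁻¹ = 0) :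
    HasSecondOrderExpansion (fun h => (f h)⁻¹) a₀⁻¹ b₁ b₂ := by
  refine of_mul_isLittleO hf.tendsto ?_ h0
  have hB : HasSecondOrderExpansion (fun h : ℝ => a₀⁻¹ + h * b₁ + h ^ 2 * b₂) a₀⁻¹ b₁ b₂ := by
    simp [HasSecondOrderExpansion]
  have h3 := hf.mul hB
  rw [h1, h2, mul_inv_cancel₀ h0] at h3
  refine h3.neg_left.congr' ?_ EventuallyEq.rfl
  filter_upwards [hf.tendsto.eventually_ne h0] with x hx
  simp only [smul_eq_mul]
  field_simp
  ring

/-- The error √f - B times √f + B is f - B², and the factor √f + B tends to 2 a₀ > 0. -/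
theorem sqrt (hf : HasSecondOrderExpansion f (a₀ ^ 2) (2 * a₀ * a₁) (2 * a₀ * a₂ + a₁ ^ 2))
    (h0 : 0 < a₀) :
    HasSecondOrderExpansion (fun h => Real.sqrt (f h)) a₀ a₁ a₂ := by
  have hs : Tendsto (fun h => Real.sqrt (f h)) (𝓝[≠] 0) (𝓝 a₀) := by
    simpa [Real.sqrt_sq h0.le] using (hf.tendsto).sqrt
  have hB : HasSecondOrderExpansion (fun h : ℝ => a₀ + h * a₁ + h ^ 2 * a₂) a₀ a₁ a₂ := by
    simp [HasSecondOrderExpansion]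
  refine of_mul_isLittleO (hs.add hB.tendsto) ?_ (by positivity)
  have h3 := hf.sub (hB.mul hB)
  refine h3.congr' ?_ EventuallyEq.rfl
  filter_upwards [hf.tendsto.eventually (lt_mem_nhds (by positivity : 0 < a₀ ^ 2))] with x hx
  have := Real.sq_sqrt hx.le
  simp only [smul_eq_mul]
  linear_combination -this

end HasSecondOrderExpansion

theorem hasSecondOrderExpansion_slope {r : ℝ → E} (hr : ContDiff ℝ 3 r) (s : ℝ) :
    HasSecondOrderExpansion (fun h => h⁻¹ • (r (s + h) - r s)) (deriv r s)
      ((1 / 2 : ℝ) • iteratedDeriv 2 r s) ((1 / 6 : ℝ) • iteratedDeriv 3 r s) := by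
  have h1 := taylor_isLittleO_univ (n := 3) (x₀ := s) (f := r) hr
  have h2 : Tendsto (fun h : ℝ => s + h) (𝓝[≠] 0) (𝓝 s) := by
    simpa using tendsto_id_punctured.const_add s
  have h3 := h1.comp_tendsto h2
  have h4 := (Asymptotics.isBigO_refl (fun h : ℝ => h⁻¹) (𝓝[≠] 0)).smul_isLittleO h3
  refine h4.congr' ?_ ?_
  · filter_upwards [self_mem_nhdsWithin] with h hh
    have hh : h ≠ 0 := hh
    simp only [Function.comp, taylorWithinEval_succ, taylor_within_zero_eval,
      iteratedDerivWithin_univ, iteratedDeriv_one, zero_add, add_sub_cancel_left]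
    have e1 : h = h⁻¹ * h ^ 2 := by field_simp
    have e2 : h ^ 2 = h⁻¹ * h ^ 3 := by field_simp
    norm_num [smul_sub, smul_add, smul_smul, Nat.factorial]
    rw [inv_mul_cancel₀ hh, show h⁻¹ * (1 / 2 * h ^ 2) = h * (1 / 2) by field_simp,
      show h⁻¹ * (1 / 6 * h ^ 3) = h ^ 2 * (1 / 6) by field_simp, one_smul]
    abel
  · filter_upwards [self_mem_nhdsWithin] with h hh
    have hh : h ≠ 0 := hh
    simp only [Function.comp, smul_eq_mul, add_sub_cancel_left]
    field_simp

end Expansion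

/-! ### Locality of the finite part -/

/-- The Hadamard finite part of the dipole interaction, in terms of the derivatives of the
curve. -/
noncomputable def dipoleFinitePart (r : ℝ → ℂ) (s : ℝ) : ℝ :=
  (2 / 3 * inner ℝ (deriv r s) (iteratedDeriv 3 r s) + 3 / 4 * ‖iteratedDeriv 2 r s‖ ^ 2
    - 9 / 4 * (inner ℝ (deriv r s) (iteratedDeriv 2 r s)) ^ 2 / ‖deriv r s‖ ^ 2)
    / ‖deriv r s‖ ^ 3

/-- A primitive of the dipole interaction density. -/
noncomputable def dipolePotential (r : ℝ → ℂ) (s η : ℝ) : ℝ :=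
  inner ℝ (r η - r s) (deriv r s) * (‖r η - r s‖⁻¹) ^ 3

/-- Applied to the difference quotient V of the curve. The linear coefficient stays existential
because it cancels between h = δ and h = -δ; the quadratic one is minus half the finite part. -/
theorem exists_hasSecondOrderExpansion_dipole {V : ℝ → ℂ} {a b c : ℂ}
    (hV : HasSecondOrderExpansion V a ((1 / 2 : ℝ) • b) ((1 / 6 : ℝ) • c)) (ha : a ≠ 0) :
    ∃ g₁ : ℝ, HasSecondOrderExpansion (fun h => inner ℝ (V h) a * (‖V h‖⁻¹) ^ 3) ‖a‖⁻¹ g₁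
      (-(1 / 2) * ((2 / 3 * inner ℝ a c + 3 / 4 * ‖b‖ ^ 2 - 9 / 4 * (inner ℝ a b) ^ 2 / ‖a‖ ^ 2)
        / ‖a‖ ^ 3)) := by
  have hv : 0 < ‖a‖ := norm_pos_iff.2 ha
  set v := ‖a‖ with hvdef
  set p : ℝ := inner ℝ a b with hp
  set q : ℝ := inner ℝ a c with hq
  have hba : inner ℝ b a = p := real_inner_comm _ _
  have hca : inner ℝ c a = q := real_inner_comm _ _
  have hA : HasSecondOrderExpansion (fun _ : ℝ => a) a 0 0 := by simp [HasSecondOrderExpansion]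
  have hN := hV.realInner hA
  have hQ := hV.realInner hV
  have hb : ‖(1 / 2 : ℝ) • b‖ = ‖b‖ / 2 := by
    rw [norm_smul, Real.norm_of_nonneg (by norm_num)]
    ring
  simp only [real_inner_smul_left, real_inner_smul_right, hb, real_inner_self_eq_norm_sq,
    inner_zero_right, ← hvdef, hba, hca, ← hp, ← hq] at hN hQ
  -- The quadratic coefficient of ‖V‖, found by matching the h² terms of ‖V‖².
  set t : ℝ := (q / 3 + ‖b‖ ^ 2 / 4 - (p / (2 * v)) ^ 2) / (2 * v) with ht
  have hS : HasSecondOrderExpansion (fun h => ‖V h‖) v (p / (2 * v)) t := by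
    have hQ' : HasSecondOrderExpansion (fun h => ‖V h‖ ^ 2) (v ^ 2) (2 * v * (p / (2 * v)))
        (2 * v * t + (p / (2 * v)) ^ 2) := by
      convert! hQ using 1
      · field_simp; ring
      · rw [ht]; field_simp; ring
    simpa [Real.sqrt_sq] using hQ'.sqrt hv
  have hI := hS.inv hv.ne' (b₁ := -(p / (2 * v)) / v ^ 2)
    (b₂ := ((p / (2 * v)) ^ 2 / v ^ 2 - t / v) / v) (by field_simp; ring) (by field_simp; ring)
  have hg := hN.mul (hI.mul (hI.mul hI))
  refine ⟨-p / v ^ 3, ?_⟩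
  convert! hg using 1
  · funext h; ring
  · field_simp
  · field_simp; ring
  · rw [ht]; field_simp; ring

theorem hasDerivAt_dipolePotential {r : ℝ → ℂ} (hr : ContDiff ℝ ∞ r) {s η : ℝ}
    (h : r η ≠ r s) : HasDerivAt (dipolePotential r s) (dipoleDensity r s η) η := by
  have hd : HasDerivAt (fun x => r x - r s) (deriv r η) η :=
    ((hr.differentiable (by simp)) η).hasDerivAt.sub_const _
  have hn : 0 < ‖r η - r s‖ := norm_pos_iff.2 (sub_ne_zero.2 h)
  have h1 := hd.inner ℝ (hasDerivAt_const η (deriv r s))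
  have h2 : HasDerivAt (fun x => ‖r x - r s‖)
      (inner ℝ (r η - r s) (deriv r η) / ‖r η - r s‖) η := by
    have h3 := (hd.norm_sq).sqrt (by positivity)
    simp only [Real.sqrt_sq (norm_nonneg _)] at h3
    convert! h3 using 1
    field_simp
  have h4 := h1.mul ((h2.inv hn.ne').pow 3)
  convert! h4 using 1
  have e : r s - r η = -(r η - r s) := by ring
  rw [dipoleDensity, e, norm_neg, inner_neg_left, inner_neg_left]
  simp only [inner_zero_right, Pi.inv_apply, Pi.pow_apply, Nat.cast_ofNat, Nat.add_one_sub_one]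
  field_simp
  ring

theorem continuousOn_dipoleDensity {r : ℝ → ℂ} (hr : ContDiff ℝ ∞ r) {s : ℝ} {A : Set ℝ}
    (hA : ∀ η ∈ A, r η ≠ r s) : ContinuousOn (dipoleDensity r s) A := by
  have hd : Continuous (deriv r) := hr.continuous_deriv (by simp)
  have hc : Continuous r := hr.continuous
  have hn : ∀ η ∈ A, ‖r s - r η‖ ≠ 0 := fun η hη =>
    norm_ne_zero_iff.2 (sub_ne_zero.2 (hA η hη).symm)
  unfold dipoleDensity
  refine ContinuousOn.add (ContinuousOn.div (by fun_prop) (by fun_prop) ?_)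
    (ContinuousOn.div (by fun_prop) (by fun_prop) ?_)
  · exact fun η hη => pow_ne_zero _ (hn η hη)
  · exact fun η hη => pow_ne_zero _ (hn η hη)

theorem integral_dipoleDensity {r : ℝ → ℂ} (hr : ContDiff ℝ ∞ r) {s a b : ℝ} (hab : a ≤ b)
    (h : ∀ η ∈ Icc a b, r η ≠ r s) :
    ∫ η in Icc a b, dipoleDensity r s η = dipolePotential r s b - dipolePotential r s a := by
  rw [integral_Icc_eq_integral_Ioc, ← intervalIntegral.integral_of_le hab]
  refine intervalIntegral.integral_eq_sub_of_hasDerivAt (fun x hx => ?_) ?_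
  · rw [uIcc_of_le hab] at hx
    exact hasDerivAt_dipolePotential hr (h x hx)
  · exact ContinuousOn.intervalIntegrable (by
      rw [uIcc_of_le hab]; exact continuousOn_dipoleDensity hr h)

/-- The finite part of the dipole interaction of a smooth closed simple curve is local. -/
theorem isFinitePart_dipoleDensity {r : ℝ → ℂ} (hr : ContDiff ℝ ∞ r) (hper : r 1 = r 0) {s : ℝ}
    (hs : s ∈ Ioo (0 : ℝ) 1) (ha : deriv r s ≠ 0)
    (hinj : ∀ η ∈ Icc (0 : ℝ) 1, η ≠ s → r η ≠ r s) :
    IsFinitePart (dipoleDensity r s) 0 1 s (dipoleFinitePart r s) := by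
  obtain ⟨hs0, hs1⟩ := hs
  -- Each side of the singularity contributes -δ⁻²/|r'(s)|; no δ⁻¹ or log δ term occurs.
  refine ⟨fun δ hδ => ?_, -2 * ‖deriv r s‖⁻¹, 0, 0, ?_⟩
  · refine ContinuousOn.integrableOn_compact (isCompact_Icc.diff isOpen_Ioo) ?_
    refine continuousOn_dipoleDensity hr fun η hη => hinj η hη.1 ?_
    rintro rfl
    exact hη.2 ⟨by linarith, by linarith⟩
  obtain ⟨g₁, hg⟩ := 
    exists_hasSecondOrderExpansion_dipole (hasSecondOrderExpansion_slope (contDiff_infty.1 hr 3) s) ha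
  set g : ℝ → ℝ := fun h => inner ℝ (h⁻¹ • (r (s + h) - r s)) (deriv r s) *
    (‖h⁻¹ • (r (s + h) - r s)‖⁻¹) ^ 3 with hgdef
  -- The prefactor h/|h|³ is odd, so P(s - δ) - P(s + δ) = -δ⁻² (g(δ) + g(-δ)), in which the odd
  -- part of g drops out.
  have hG : ∀ h : ℝ, h ≠ 0 → dipolePotential r s (s + h) = h / |h| ^ 3 * g h := by
    intro h hh
    have : 0 < |h| := abs_pos.2 hh
    simp only [hgdef, dipolePotential, real_inner_smul_left, norm_smul, norm_inv, Real.norm_eq_abs,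
      mul_inv, inv_inv]
    field_simp
  clear_value g
  have hpos : Tendsto (fun δ : ℝ => δ) (𝓝[>] 0) (𝓝[≠] 0) :=
    tendsto_id.mono_left (nhdsWithin_mono _ fun x hx => (ne_of_gt hx : x ≠ 0))
  have hneg : Tendsto (fun δ : ℝ => -δ) (𝓝[>] 0) (𝓝[≠] 0) := by
    refine tendsto_nhdsWithin_iff.2 ⟨?_, ?_⟩
    · simpa using (tendsto_nhdsWithin_of_tendsto_nhds (tendsto_id (x := 𝓝 (0 : ℝ)))
        (s := Ioi 0)).neg
    · filter_upwards [self_mem_nhdsWithin] with x hx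
      exact neg_ne_zero.2 (ne_of_gt hx)
  have h0 := hg.tendsto_div_nhds_zero
  have h1 := ((h0.comp hpos).add (h0.comp hneg)).neg.add_const (dipoleFinitePart r s)
  simp only [add_zero, neg_zero, zero_add] at h1
  refine h1.congr' ?_
  filter_upwards [self_mem_nhdsWithin,
    mem_nhdsWithin_of_mem_nhds (Iio_mem_nhds hs0),
    mem_nhdsWithin_of_mem_nhds (Iio_mem_nhds (sub_pos.2 hs1))] with δ hδ hδs hδ1
  have hδ : 0 < δ := hδ
  have hδs : δ < s := hδs
  have hδ1 : δ < 1 - s := hδ1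
  have hset : Icc (0 : ℝ) 1 \ Ioo (s - δ) (s + δ) = Icc 0 (s - δ) ∪ Icc (s + δ) 1 := by
    ext x
    simp only [Set.mem_sdiff, mem_Icc, mem_Ioo, mem_union, not_and_or, not_lt]
    constructor
    · rintro ⟨⟨h1, h2⟩, h3 | h3⟩
      · exact Or.inl ⟨h1, h3⟩
      · exact Or.inr ⟨h3, h2⟩
    · rintro (⟨h1, h2⟩ | ⟨h1, h2⟩)
      · exact ⟨⟨h1, by linarith⟩, Or.inl h2⟩
      · exact ⟨⟨by linarith, h2⟩, Or.inr h1⟩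
  have hL : ∀ η ∈ Icc 0 (s - δ), r η ≠ r s := fun η hη =>
    hinj η ⟨hη.1, by linarith [hη.2]⟩ (by linarith [hη.2] : η < s).ne
  have hR : ∀ η ∈ Icc (s + δ) 1, r η ≠ r s := fun η hη =>
    hinj η ⟨by linarith [hη.1], hη.2⟩ (by linarith [hη.1] : s < η).ne'
  have hdis : Disjoint (Icc 0 (s - δ)) (Icc (s + δ) 1) :=
    Set.disjoint_left.2 fun x hx hx' => by linarith [hx.2, hx'.1]
  have hint : ∀ {A B : ℝ}, (∀ η ∈ Icc A B, r η ≠ r s) →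
      IntegrableOn (dipoleDensity r s) (Icc A B) := fun h =>
    ContinuousOn.integrableOn_compact isCompact_Icc (continuousOn_dipoleDensity hr h)
  rw [hset, setIntegral_union hdis measurableSet_Icc (hint hL) (hint hR),
    integral_dipoleDensity hr (by linarith) hL, integral_dipoleDensity hr (by linarith) hR]
  -- Closedness of the curve removes the contributions of the endpoints 0 and 1.
  have e0 : dipolePotential r s 1 = dipolePotential r s 0 := by
    simp only [dipolePotential, hper]
  have e1 := hG δ hδ.ne'
  have e2 := hG (-δ) (neg_ne_zero.2 hδ.ne')
  rw [← sub_eq_add_neg] at e2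
  rw [e0, e1, e2, abs_neg, abs_of_pos hδ, dipoleFinitePart]
  simp only [Function.comp, smul_eq_mul]
  field_simp
  ring

/-! ### Finite part of a curve of nearly unit speed -/

theorem hasDerivAt_iteratedDeriv {F : Type*} [NormedAddCommGroup F] [NormedSpace ℝ F]
    {f : ℝ → F} (hf : ContDiff ℝ ∞ f) (j : ℕ) (s : ℝ) :
    HasDerivAt (iteratedDeriv j f) (iteratedDeriv (j + 1) f s) s := by
  rw [iteratedDeriv_succ]
  exact ((contDiff_infty.1 hf (j + 1)).differentiable_iteratedDeriv' j s).hasDerivAt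

theorem continuous_iteratedDeriv_of_smooth {F : Type*} [NormedAddCommGroup F] [NormedSpace ℝ F]
    {f : ℝ → F} (hf : ContDiff ℝ ∞ f) (j : ℕ) : Continuous (iteratedDeriv j f) :=
  hf.continuous_iteratedDeriv j (by exact_mod_cast le_top)

/-- The speed of a regular curve, with its first two derivatives, determines the tangential
components of the second and third derivatives of the curve. -/
theorem inner_deriv_iteratedDeriv {r : ℝ → ℂ} (hr : ContDiff ℝ ∞ r) (ha : ∀ s, deriv r s ≠ 0)
    (s : ℝ) :
    inner ℝ (deriv r s) (iteratedDeriv 2 r s) = ‖deriv r s‖ * deriv (fun t => ‖deriv r t‖) s ∧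
    inner ℝ (deriv r s) (iteratedDeriv 3 r s) = deriv (fun t => ‖deriv r t‖) s ^ 2
      + ‖deriv r s‖ * iteratedDeriv 2 (fun t => ‖deriv r t‖) s - ‖iteratedDeriv 2 r s‖ ^ 2 := by
  have hd : ContDiff ℝ ∞ (deriv r) := (contDiff_infty_iff_deriv.1 hr).2
  have hv : ContDiff ℝ ∞ (fun t => ‖deriv r t‖) := hd.norm ℝ ha
  have h1 : ∀ x, HasDerivAt (deriv r) (iteratedDeriv 2 r x) x := fun x => by
    simpa using hasDerivAt_iteratedDeriv hr 1 x
  have h2 : ∀ x, HasDerivAt (fun t => ‖deriv r t‖) (deriv (fun t => ‖deriv r t‖) x) x := fun x => by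
    simpa using hasDerivAt_iteratedDeriv hv 0 x
  have h3 : HasDerivAt (deriv fun t => ‖deriv r t‖)
      (iteratedDeriv 2 (fun t => ‖deriv r t‖) s) s := by
    simpa using hasDerivAt_iteratedDeriv hv 1 s
  have key : ∀ x, inner ℝ (deriv r x) (iteratedDeriv 2 r x)
      = ‖deriv r x‖ * deriv (fun t => ‖deriv r t‖) x := by
    intro x
    have := (h1 x).norm_sq.unique ((h2 x).pow 2)
    simp only [Nat.cast_ofNat, Nat.add_one_sub_one, pow_one] at this
    linarith
  refine ⟨key s, ?_⟩
  have h4 := (h1 s).inner ℝ (hasDerivAt_iteratedDeriv hr 2 s)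
  rw [show (fun t => inner ℝ (deriv r t) (iteratedDeriv 2 r t))
    = fun x => ‖deriv r x‖ * deriv (fun t => ‖deriv r t‖) x from funext key] at h4
  have h5 := h4.unique ((h2 s).mul h3)
  rw [real_inner_self_eq_norm_sq] at h5
  linarith

/-- Eliminating the tangential components of r'' and r''' exhibits the factor 3/4 - 2/3 = 1/12 of
|r''|²; every other numerator term contains a derivative of the speed. -/
theorem dipoleFinitePart_eq {r : ℝ → ℂ} (hr : ContDiff ℝ ∞ r) (ha : ∀ s, deriv r s ≠ 0) (s : ℝ) :
    dipoleFinitePart r s = (‖iteratedDeriv 2 r s‖ ^ 2 / 12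
      + 2 / 3 * ‖deriv r s‖ * iteratedDeriv 2 (fun t => ‖deriv r t‖) s
      - 19 / 12 * deriv (fun t => ‖deriv r t‖) s ^ 2) / ‖deriv r s‖ ^ 3 := by
  obtain ⟨h1, h2⟩ := inner_deriv_iteratedDeriv hr ha s
  have : ‖deriv r s‖ ≠ 0 := norm_ne_zero_iff.2 (ha s)
  rw [dipoleFinitePart, h1, h2]
  field_simp
  ring

theorem continuous_dipoleFinitePart {r : ℝ → ℂ} (hr : ContDiff ℝ ∞ r) (ha : ∀ s, deriv r s ≠ 0) :
    Continuous (dipoleFinitePart r) := by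
  have h1 : Continuous (deriv r) := by simpa using continuous_iteratedDeriv_of_smooth hr 1
  have h2 := continuous_iteratedDeriv_of_smooth hr 2
  have h3 := continuous_iteratedDeriv_of_smooth hr 3
  have h0 : ∀ s, ‖deriv r s‖ ≠ 0 := fun s => norm_ne_zero_iff.2 (ha s)
  unfold dipoleFinitePart
  refine Continuous.div (Continuous.sub (by fun_prop) (Continuous.div (by fun_prop) (by fun_prop)
    fun s => pow_ne_zero _ (h0 s))) (by fun_prop) fun s => pow_ne_zero _ (h0 s)

theorem abs_dipoleFinitePart_sub_le {b v v₁ v₂ τ M : ℝ} (hb : 0 ≤ b) (hbM : b ≤ M)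
    (hτ : τ ≤ 1 / 2) (hv : |v - 1| ≤ τ) (hv₁ : |v₁| ≤ τ) (hv₂ : |v₂| ≤ τ) :
    |(b / 12 + 2 / 3 * v * v₂ - 19 / 12 * v₁ ^ 2) / v ^ 3 - 1 / 12 * b| ≤ (4 * M + 16) * τ := by
  have hM : 0 ≤ M := hb.trans hbM
  have hτ0 : 0 ≤ τ := (abs_nonneg _).trans hv
  obtain ⟨hva, hvb⟩ := abs_le.1 hv
  have hvpos : 1 / 2 ≤ v := by linarith
  have hv3 : 1 / 8 ≤ v ^ 3 := by
    calc (1 / 8 : ℝ) = (1 / 2) ^ 3 := by norm_num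
      _ ≤ v ^ 3 := by gcongr
  have e : (b / 12 + 2 / 3 * v * v₂ - 19 / 12 * v₁ ^ 2) / v ^ 3 - 1 / 12 * b
      = (b / 12 * ((1 - v) * (1 + v + v ^ 2)) + 2 / 3 * v * v₂ - 19 / 12 * v₁ ^ 2) / v ^ 3 := by
    have : v ≠ 0 := by linarith
    field_simp
    ring
  have h1 : |b / 12 * ((1 - v) * (1 + v + v ^ 2))| ≤ M / 12 * (τ * 5) := by
    rw [abs_mul, abs_mul, abs_of_nonneg (by positivity : 0 ≤ b / 12), abs_sub_comm,
      abs_of_nonneg (by positivity : 0 ≤ 1 + v + v ^ 2)]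
    have : 1 + v + v ^ 2 ≤ 5 := by nlinarith
    gcongr
  have h2 : |2 / 3 * v * v₂| ≤ 1 * τ := by
    rw [abs_mul]
    gcongr
    rw [abs_of_nonneg (by positivity)]
    linarith
  have h3 : |19 / 12 * v₁ ^ 2| ≤ 19 / 12 * (τ * (1 / 2)) := by
    rw [abs_mul, abs_pow, abs_of_pos (by norm_num : (0 : ℝ) < 19 / 12)]
    have : |v₁| ^ 2 ≤ τ * (1 / 2) := by nlinarith [abs_nonneg v₁]
    gcongr
  rw [e, abs_div, abs_of_pos (by positivity : 0 < v ^ 3), div_le_iff₀ (by positivity)]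
  -- The numerator is at most (5M/12 + 1 + 19/24) τ ≤ (M/2 + 2) τ, and the denominator is at least
  -- 1/8; this explains 4M + 16.
  have h4 : (4 * M + 16) * τ * (1 / 8) ≤ (4 * M + 16) * τ * v ^ 3 := by gcongr
  refine le_trans ((abs_sub _ _).trans (add_le_add (abs_add_le _ _) le_rfl)) ?_
  nlinarith [mul_nonneg hM hτ0]

/-- The speed of a nearly inextensible curve is bounded away from zero, and its derivatives are
small. -/
theorem IsInextensibleUpTo.speed_bounds {r : ℝ → ℂ} {τ : ℝ} (hτ : τ ≤ 1 / 2)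
    (hu : IsInextensibleUpTo τ r) (s : ℝ) :
    deriv r s ≠ 0 ∧ |‖deriv r s‖ - 1| ≤ τ ∧ |deriv (fun t => ‖deriv r t‖) s| ≤ τ ∧
      |iteratedDeriv 2 (fun t => ‖deriv r t‖) s| ≤ τ := by
  have hv0 : |‖deriv r s‖ - 1| ≤ τ := by simpa using hu 0 (by norm_num) s
  refine ⟨fun h => ?_, hv0, by simpa [deriv_sub_const] using hu 1 (by norm_num) s, ?_⟩
  · norm_num [h] at hv0
    linarith
  · have e : deriv (fun t => ‖deriv r t‖ - 1) = deriv (fun t => ‖deriv r t‖) :=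
      funext fun x => deriv_sub_const _
    have := hu 2 (by norm_num) s
    rwa [iteratedDeriv_succ', e, ← iteratedDeriv_succ'] at this

/-- For a closed simple curve of nearly constant unit speed, the nonlocal energy is one twelfth of
the local one. -/
theorem nonlocalEnergy_sub_localEnergy {r : ℝ → ℂ} (hr : ContDiff ℝ ∞ r) (hper : r 1 = r 0)
    (hinj : ∀ s ∈ Ioo (0 : ℝ) 1, ∀ η ∈ Icc (0 : ℝ) 1, η ≠ s → r η ≠ r s) {τ M : ℝ}
    (hτ : τ ≤ 1 / 2) (hu : IsInextensibleUpTo τ r)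
    (hM : ∀ s, ‖iteratedDeriv 2 r s‖ ^ 2 ≤ M) :
    (∀ s ∈ Ioo (0 : ℝ) 1, ∃ v, IsFinitePart (dipoleDensity r s) 0 1 s v) ∧
    IntervalIntegrable (fun s => finitePart (dipoleDensity r s) 0 1 s) volume 0 1 ∧
    |nonlocalEnergy r - 1 / 12 * localEnergy r| ≤ (4 * M + 16) * τ := by
  have hv := hu.speed_bounds hτ
  have ha : ∀ s, deriv r s ≠ 0 := fun s => (hv s).1
  have hfp : ∀ s ∈ Ioo (0 : ℝ) 1, IsFinitePart (dipoleDensity r s) 0 1 s (dipoleFinitePart r s) :=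
    fun s hs => isFinitePart_dipoleDensity hr hper hs (ha s) (hinj s hs)
  have hc := continuous_dipoleFinitePart hr ha
  have hae : ∀ᵐ s ∂volume, s ∈ Set.uIoc (0 : ℝ) 1 →
      dipoleFinitePart r s = finitePart (dipoleDensity r s) 0 1 s := by
    -- The half-open interval contains s = 1, where the finite part is not covered; this point is
    -- null.
    have h1 : ∀ᵐ s : ℝ ∂volume, s ≠ 1 := by simp [ae_iff]
    filter_upwards [h1] with s hs hs'
    rw [uIoc_of_le zero_le_one] at hs'
    exact (hfp s ⟨hs'.1, lt_of_le_of_ne hs'.2 hs⟩).finitePart_eq.symm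
  have hae' := (ae_restrict_iff' measurableSet_uIoc).2 hae
  refine ⟨fun s hs => ⟨_, hfp s hs⟩, (hc.intervalIntegrable 0 1).congr_ae hae', ?_⟩
  have hb : Continuous (fun s => ‖iteratedDeriv 2 r s‖ ^ 2) :=
    (continuous_iteratedDeriv_of_smooth hr 2).norm.pow 2
  rw [nonlocalEnergy, localEnergy, ← intervalIntegral.integral_congr_ae hae,
    ← intervalIntegral.integral_const_mul, ← intervalIntegral.integral_sub
      (hc.intervalIntegrable 0 1) ((hb.const_mul _).intervalIntegrable 0 1)]
  have h := intervalIntegral.norm_integral_le_of_norm_le_const (a := 0) (b := 1)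
    (C := (4 * M + 16) * τ)
    (f := fun s => dipoleFinitePart r s - 1 / 12 * ‖iteratedDeriv 2 r s‖ ^ 2) (fun s _ => by
      rw [dipoleFinitePart_eq hr ha s]
      obtain ⟨-, h0, h1, h2⟩ := hv s
      exact abs_dipoleFinitePart_sub_le (by positivity) (hM s) hτ h0 h1 h2)
  simpa using h

/-! ### Polynomial algebra of speed and acceleration -/

section Jets

variable (ε u₀ u₁ u₂ u₃ w₁ w₂ w₃ : ℝ)

/-- The second-order part of the squared speed, as a polynomial in the derivatives of the
displacements. -/
def speedRemainder : ℝ :=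
  u₁ ^ 2 + u₀ ^ 2 + w₁ ^ 2 - 4 * u₀ * w₁ + 2 * ε * (u₀ ^ 2 * w₁ - u₀ * w₁ ^ 2)
    + ε ^ 2 * u₀ ^ 2 * w₁ ^ 2

/-- The first derivative of `speedRemainder` along a displacement. -/
def speedRemainderDeriv : ℝ :=
  2 * u₁ * u₂ + 2 * u₀ * u₁ + 2 * w₁ * w₂ - 4 * u₁ * w₁ - 4 * u₀ * w₂
    + 2 * ε * (2 * u₀ * u₁ * w₁ + u₀ ^ 2 * w₂ - u₁ * w₁ ^ 2 - 2 * u₀ * w₁ * w₂)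
    + ε ^ 2 * (2 * u₀ * u₁ * w₁ ^ 2 + 2 * u₀ ^ 2 * w₁ * w₂)

/-- The second derivative of `speedRemainder` along a displacement. -/
def speedRemainderDerivTwo : ℝ :=
  2 * u₂ ^ 2 + 2 * u₁ * u₃ + 2 * u₁ ^ 2 + 2 * u₀ * u₂ + 2 * w₂ ^ 2 + 2 * w₁ * w₃
    - 4 * u₂ * w₁ - 8 * u₁ * w₂ - 4 * u₀ * w₃
    + 2 * ε * (2 * u₁ ^ 2 * w₁ + 2 * u₀ * u₂ * w₁ + 4 * u₀ * u₁ * w₂ + u₀ ^ 2 * w₃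
      - u₂ * w₁ ^ 2 - 4 * u₁ * w₁ * w₂ - 2 * u₀ * w₂ ^ 2 - 2 * u₀ * w₁ * w₃)
    + ε ^ 2 * (2 * u₁ ^ 2 * w₁ ^ 2 + 2 * u₀ * u₂ * w₁ ^ 2 + 8 * u₀ * u₁ * w₁ * w₂
      + 2 * u₀ ^ 2 * w₂ ^ 2 + 2 * u₀ ^ 2 * w₁ * w₃)

/-- The squared speed of a deformed unit circle, with respect to the angle. -/
def speedSq : ℝ := 1 - 2 * ε * (u₀ - w₁) + ε ^ 2 * speedRemainder ε u₀ u₁ w₁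

/-- The squared norm of the second derivative of a deformed unit circle, with respect to the
angle. -/
def accelSq : ℝ :=
  (-(ε * u₂) - (1 - ε * u₀) * (1 + ε * w₁) ^ 2) ^ 2
    + (-(2 * ε * u₁ * (1 + ε * w₁)) + (1 - ε * u₀) * (ε * w₂)) ^ 2

/-- The cubic part of `accelSq - speedSq`. -/
def accelRemainder : ℝ :=
  2 * (u₂ + 2 * w₁ - u₀) * (w₁ ^ 2 - 2 * u₀ * w₁) - 2 * u₀ * w₁ ^ 2
    + 2 * (w₂ - 2 * u₁) * (-(2 * u₁ * w₁) - u₀ * w₂) - 2 * (u₀ ^ 2 * w₁ - u₀ * w₁ ^ 2)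
    + ε * ((w₁ ^ 2 - 2 * u₀ * w₁) ^ 2 - 2 * (u₂ + 2 * w₁ - u₀) * (u₀ * w₁ ^ 2)
      + (2 * u₁ * w₁ + u₀ * w₂) ^ 2 - u₀ ^ 2 * w₁ ^ 2)
    - 2 * ε ^ 2 * (w₁ ^ 2 - 2 * u₀ * w₁) * (u₀ * w₁ ^ 2) + ε ^ 3 * (u₀ * w₁ ^ 2) ^ 2

/-- After `speedSq` is split off, the terms are the bending density, an exact derivative, products
containing ε times u₀ - w₁, u₁ - w₂ or u₂ - w₃, and a cubic remainder. The three differences are u -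
w' and its first two derivatives, which inextensibility controls. -/
theorem accelSq_eq :
    accelSq ε u₀ u₁ u₂ w₁ w₂ = speedSq ε u₀ u₁ w₁ + ε ^ 2 * (w₁ ^ 2 - 2 * w₂ ^ 2 + w₃ ^ 2)
      + (2 * ε * u₂ + 2 * ε * w₁ + 2 * ε ^ 2 * (w₃ * w₁ + w₂ ^ 2))
      + ε * ((ε * (u₂ - w₃) - ε * (u₀ - w₁)) * (2 * (w₁ + w₃) + (u₂ - w₃) - (u₀ - w₁))
        - ε * (u₀ - w₁) * (u₀ + w₁) + ε * (u₁ - w₂) * (3 * u₁ - w₂))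
      + ε ^ 3 * accelRemainder ε u₀ u₁ u₂ w₁ w₂ := by
  simp only [accelSq, speedSq, speedRemainder, accelRemainder]
  ring

end Jets

/-- Compactness of the cube [-K, K]⁸ replaces explicit bounds of the remainder polynomials. -/
theorem exists_jet_bound (f : ℝ → ℝ → ℝ → ℝ → ℝ → ℝ → ℝ → ℝ → ℝ)
    (hf : Continuous fun x : Fin 8 → ℝ => f (x 0) (x 1) (x 2) (x 3) (x 4) (x 5) (x 6) (x 7))
    (K : ℝ) :
    ∃ C, 0 ≤ C ∧ ∀ ε u₀ u₁ u₂ u₃ w₁ w₂ w₃ : ℝ, |ε| ≤ K → |u₀| ≤ K → |u₁| ≤ K → |u₂| ≤ K →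
      |u₃| ≤ K → |w₁| ≤ K → |w₂| ≤ K → |w₃| ≤ K → |f ε u₀ u₁ u₂ u₃ w₁ w₂ w₃| ≤ C := by
  obtain ⟨C, hC⟩ := (isCompact_Icc (a := fun _ : Fin 8 => -K) (b := fun _ => K)).exists_bound_of_continuousOn
    hf.continuousOn
  refine ⟨max C 0, le_max_right _ _, fun ε u₀ u₁ u₂ u₃ w₁ w₂ w₃ h0 h1 h2 h3 h4 h5 h6 h7 => ?_⟩
  refine le_trans ?_ (le_max_left _ _)
  refine hC ![ε, u₀, u₁, u₂, u₃, w₁, w₂, w₃] ⟨fun i => ?_, fun i => ?_⟩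
  · fin_cases i <;> exact (abs_le.1 (by assumption)).1
  · fin_cases i <;> exact (abs_le.1 (by assumption)).2

theorem exists_accelSq_bound {K : ℝ} (hK : 1 ≤ K) (M : ℝ) :
    ∃ C, 0 ≤ C ∧ ∀ ε t u₀ u₁ u₂ u₃ w₁ w₂ w₃ : ℝ, 0 < ε → ε ≤ 1 → ε ^ 3 ≤ t →
      |u₀| ≤ K → |u₁| ≤ K → |u₂| ≤ K → |u₃| ≤ K → |w₁| ≤ K → |w₂| ≤ K → |w₃| ≤ K →
      |speedSq ε u₀ u₁ w₁ - 1| ≤ M * t →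
      |-2 * ε * (u₁ - w₂) + ε ^ 2 * speedRemainderDeriv ε u₀ u₁ u₂ w₁ w₂| ≤ M * t →
      |-2 * ε * (u₂ - w₃) + ε ^ 2 * speedRemainderDerivTwo ε u₀ u₁ u₂ u₃ w₁ w₂ w₃| ≤ M * t →
      |accelSq ε u₀ u₁ u₂ w₁ w₂ - (1 + ε ^ 2 * (w₁ ^ 2 - 2 * w₂ ^ 2 + w₃ ^ 2)
        + (2 * ε * u₂ + 2 * ε * w₁ + 2 * ε ^ 2 * (w₃ * w₁ + w₂ ^ 2)))| ≤ C * t := by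
  obtain ⟨C₀, hC₀, h0⟩ := exists_jet_bound (fun ε u₀ u₁ _ _ w₁ _ _ => speedRemainder ε u₀ u₁ w₁)
    (by simp only [speedRemainder]; fun_prop) K
  obtain ⟨C₁, hC₁, h1⟩ := exists_jet_bound
    (fun ε u₀ u₁ u₂ _ w₁ w₂ _ => speedRemainderDeriv ε u₀ u₁ u₂ w₁ w₂)
    (by simp only [speedRemainderDeriv]; fun_prop) K
  obtain ⟨C₂, hC₂, h2⟩ := exists_jet_bound speedRemainderDerivTwo
    (by simp only [speedRemainderDerivTwo]; fun_prop) K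
  obtain ⟨C₃, hC₃, h3⟩ := exists_jet_bound
    (fun ε u₀ u₁ u₂ _ w₁ w₂ _ => accelRemainder ε u₀ u₁ u₂ w₁ w₂)
    (by simp only [accelRemainder]; fun_prop) K
  refine ⟨|M| + (8 * K * (C₂ + |M|) + 10 * K * (C₀ + |M|) + 4 * K * (C₁ + |M|)) + C₃,
    by positivity, ?_⟩
  intro ε t u₀ u₁ u₂ u₃ w₁ w₂ w₃ hε hε1 ht hu0 hu1 hu2 hu3 hw1 hw2 hw3 hs0 hs1 hs2
  have hεK : |ε| ≤ K := by rw [abs_of_pos hε]; linarith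
  replace h0 := h0 ε u₀ u₁ u₂ u₃ w₁ w₂ w₃ hεK hu0 hu1 hu2 hu3 hw1 hw2 hw3
  replace h1 := h1 ε u₀ u₁ u₂ u₃ w₁ w₂ w₃ hεK hu0 hu1 hu2 hu3 hw1 hw2 hw3
  replace h2 := h2 ε u₀ u₁ u₂ u₃ w₁ w₂ w₃ hεK hu0 hu1 hu2 hu3 hw1 hw2 hw3
  replace h3 := h3 ε u₀ u₁ u₂ u₃ w₁ w₂ w₃ hεK hu0 hu1 hu2 hu3 hw1 hw2 hw3
  have ht0 : 0 < t := lt_of_lt_of_le (by positivity) ht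
  have hMt : M * t ≤ |M| * t := by gcongr; exact le_abs_self M
  -- A constraint -2εd + ε²X = O(t) yields only εd = O(ε² + t); the additional factor ε makes this
  -- O(t), because ε³ ≤ t and ε ≤ 1.
  have key : ∀ {d X c : ℝ}, |X| ≤ c → 0 ≤ c → |-2 * ε * d + ε ^ 2 * X| ≤ M * t →
      |ε * (ε * d)| ≤ (c + |M|) * t := by
    intro d X c hX hc h
    have e : ε * (ε * d) = (1 / 2) * (ε ^ 3 * X - ε * (-2 * ε * d + ε ^ 2 * X)) := by ring
    have e1 : |ε ^ 3 * X| ≤ t * c := by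
      rw [abs_mul, abs_of_pos (by positivity)]
      gcongr
    have e2 : |ε * (-2 * ε * d + ε ^ 2 * X)| ≤ 1 * (|M| * t) := by
      rw [abs_mul, abs_of_pos hε]
      gcongr
      exact h.trans hMt
    have e3 := abs_sub (ε ^ 3 * X) (ε * (-2 * ε * d + ε ^ 2 * X))
    rw [e, abs_mul, abs_of_pos (by norm_num : (0 : ℝ) < 1 / 2)]
    have : 0 ≤ |ε ^ 3 * X - ε * (-2 * ε * d + ε ^ 2 * X)| := abs_nonneg _
    linarith
  have k0 := key h0 hC₀ (d := u₀ - w₁) (by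
    rw [speedSq] at hs0
    convert! hs0 using 2
    ring)
  have k1 := key h1 hC₁ hs1
  have k2 := key h2 hC₂ hs2
  rw [accelSq_eq ε u₀ u₁ u₂ w₁ w₂ w₃]
  -- Regrouped so that each defect u - w', u' - w'' and u'' - w''' carries the factor ε² required by
  -- `key`.
  have e : speedSq ε u₀ u₁ w₁ + ε ^ 2 * (w₁ ^ 2 - 2 * w₂ ^ 2 + w₃ ^ 2)
      + (2 * ε * u₂ + 2 * ε * w₁ + 2 * ε ^ 2 * (w₃ * w₁ + w₂ ^ 2))
      + ε * ((ε * (u₂ - w₃) - ε * (u₀ - w₁)) * (2 * (w₁ + w₃) + (u₂ - w₃) - (u₀ - w₁))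
        - ε * (u₀ - w₁) * (u₀ + w₁) + ε * (u₁ - w₂) * (3 * u₁ - w₂))
      + ε ^ 3 * accelRemainder ε u₀ u₁ u₂ w₁ w₂ - (1 + ε ^ 2 * (w₁ ^ 2 - 2 * w₂ ^ 2 + w₃ ^ 2)
        + (2 * ε * u₂ + 2 * ε * w₁ + 2 * ε ^ 2 * (w₃ * w₁ + w₂ ^ 2)))
      = (speedSq ε u₀ u₁ w₁ - 1)
        + ((2 * w₁ + w₃ + u₂ - u₀ + w₁) * (ε * (ε * (u₂ - w₃)))
          - (2 * w₁ + w₃ + u₂ - u₀ + w₁ + (u₀ + w₁)) * (ε * (ε * (u₀ - w₁)))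
          + (3 * u₁ - w₂) * (ε * (ε * (u₁ - w₂))))
        + ε ^ 3 * accelRemainder ε u₀ u₁ u₂ w₁ w₂ := by ring
  rw [e]
  rw [abs_le] at hu0 hu1 hu2 hw1 hw2 hw3
  have b2 : |(2 * w₁ + w₃ + u₂ - u₀ + w₁) * (ε * (ε * (u₂ - w₃)))| ≤ 8 * K * ((C₂ + |M|) * t) := by
    rw [abs_mul]
    gcongr
    rw [abs_le]; constructor <;> linarith
  have b0 : |(2 * w₁ + w₃ + u₂ - u₀ + w₁ + (u₀ + w₁)) * (ε * (ε * (u₀ - w₁)))|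
      ≤ 10 * K * ((C₀ + |M|) * t) := by
    rw [abs_mul]
    gcongr
    rw [abs_le]; constructor <;> linarith
  have b1 : |(3 * u₁ - w₂) * (ε * (ε * (u₁ - w₂)))| ≤ 4 * K * ((C₁ + |M|) * t) := by
    rw [abs_mul]
    gcongr
    rw [abs_le]; constructor <;> linarith
  have b3 : |ε ^ 3 * accelRemainder ε u₀ u₁ u₂ w₁ w₂| ≤ t * C₃ := by
    rw [abs_mul, abs_of_pos (by positivity)]
    gcongr
  refine (abs_add_le _ _).trans ((add_le_add ((abs_add_le _ _).trans (add_le_add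
    (hs0.trans hMt) ((abs_add_le _ _).trans (add_le_add ((abs_sub _ _).trans
      (add_le_add b2 b0)) b1)))) b3).trans (le_of_eq ?_))
  ring

/-! ### Geometry of the deformed circle -/

/-- With x = π/n one has 2πR = x / sin x, and x - x³/6 < sin x < x. The bound n ≥ 4 ensures x ≤ 1.
-/
theorem ringRadius_bounds {n : ℕ} (hn : 4 ≤ n) :
    1 ≤ 2 * π * ringRadius n ∧ 2 * π * ringRadius n ≤ 1 + 2 * (1 / (n : ℝ) ^ 2) := by
  have hn' : (4 : ℝ) ≤ n := by exact_mod_cast hn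
  have hn0 : (0 : ℝ) < n := by linarith
  set x : ℝ := π / n with hx
  have hx0 : 0 < x := by positivity
  have hx1 : x ≤ 1 := by rw [hx, div_le_one hn0]; linarith [Real.pi_lt_four]
  have h1 : Real.sin x ≤ x := (Real.sin_lt hx0).le
  have h2 : x - x ^ 3 / 6 < Real.sin x := Real.sin_gt_sub_cube hx0
  have hs : 0 < Real.sin x := by nlinarith [mul_pos hx0 hx0]
  have e : 2 * π * ringRadius n = x / Real.sin x := by
    rw [ringRadius, ← hx, hx]
    field_simp
  have hx2 : x ^ 2 ≤ 10 * (1 / (n : ℝ) ^ 2) := by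
    have hpi : π ^ 2 ≤ 10 := by nlinarith [Real.pi_lt_d2, Real.pi_pos]
    rw [hx, div_pow, div_eq_mul_one_div]
    gcongr
  rw [e]
  refine ⟨(one_le_div hs).2 h1, ?_⟩
  have h3 : x / Real.sin x ≤ 1 + x ^ 2 / 5 := by
    rw [div_le_iff₀ hs]
    have h4 : x ≤ (1 + x ^ 2 / 5) * (x - x ^ 3 / 6) := by
      have : 0 ≤ x ^ 3 * (1 - x ^ 2) := mul_nonneg (by positivity) (by nlinarith)
      nlinarith
    refine h4.trans ?_
    gcongr
  linarith

section Ring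

variable {n : ℕ} {ε : ℝ} {w u : ℝ → ℝ}

/-- In the rotating frame exp(iφ) a derivative acts on the prefactor alone, so the norms of r' and
r'' can be read off from its real and imaginary parts. -/
theorem hasDerivAt_ofReal_mul_exp {f : ℝ → ℂ} {f' : ℂ} {φ : ℝ → ℝ} {φ' s : ℝ}
    (hf : HasDerivAt f f' s) (hφ : HasDerivAt φ φ' s) :
    HasDerivAt (fun t => f t * Complex.exp (φ t * Complex.I))
      ((f' + f s * φ' * Complex.I) * Complex.exp (φ s * Complex.I)) s := by
  convert! hf.mul ((hφ.ofReal_comp.mul_const Complex.I).cexp) using 1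
  ring

theorem deformedRing_eq (n : ℕ) (ε : ℝ) (w u : ℝ → ℝ) : deformedRing n ε w u = fun s =>
    ((ringRadius n * (1 - ε * u (2 * π * s)) : ℝ) : ℂ) *
      Complex.exp ((2 * π * s + ε * w (2 * π * s) : ℝ) * Complex.I) := by
  funext s
  rw [deformedRing, Complex.exp_mul_I, ← Complex.ofReal_cos, ← Complex.ofReal_sin]

theorem contDiff_deformedRing (hw : ContDiff ℝ ∞ w) (hu : ContDiff ℝ ∞ u) :
    ContDiff ℝ ∞ (deformedRing n ε w u) := by
  rw [deformedRing_eq]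
  have h : ∀ {f : ℝ → ℝ}, ContDiff ℝ ∞ f → ContDiff ℝ ∞ fun s => (f s : ℂ) := fun hf =>
    Complex.ofRealCLM.contDiff.comp hf
  exact (h (by fun_prop)).mul ((h (by fun_prop)).mul contDiff_const).cexp

theorem hasDerivAt_iteratedDeriv_const_mul {f : ℝ → ℝ} (hf : ContDiff ℝ ∞ f) (j : ℕ) (c s : ℝ) :
    HasDerivAt (fun t => iteratedDeriv j f (c * t)) (c * iteratedDeriv (j + 1) f (c * s)) s := by
  have h := (hasDerivAt_iteratedDeriv hf j (c * s)).comp s ((hasDerivAt_id s).const_mul c)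
  convert! h using 1
  simp [mul_comm]

theorem norm_ofReal_add_ofReal_mul_I_mul_exp_sq (x y φ : ℝ) :
    ‖((x : ℂ) + y * Complex.I) * Complex.exp (φ * Complex.I)‖ ^ 2 = x ^ 2 + y ^ 2 := by
  rw [norm_mul, Complex.norm_exp_ofReal_mul_I, mul_one, Complex.sq_norm, Complex.normSq_add_mul_I]

theorem norm_deriv_deformedRing_sq (hw : ContDiff ℝ ∞ w) (hu : ContDiff ℝ ∞ u) (s : ℝ) :
    ‖deriv (deformedRing n ε w u) s‖ ^ 2 = (2 * π * ringRadius n) ^ 2 *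
        speedSq ε (u (2 * π * s)) (iteratedDeriv 1 u (2 * π * s)) (iteratedDeriv 1 w (2 * π * s)) ∧
    ‖iteratedDeriv 2 (deformedRing n ε w u) s‖ ^ 2 = (2 * π) ^ 2 * (2 * π * ringRadius n) ^ 2 *
      accelSq ε (u (2 * π * s)) (iteratedDeriv 1 u (2 * π * s)) (iteratedDeriv 2 u (2 * π * s))
        (iteratedDeriv 1 w (2 * π * s)) (iteratedDeriv 2 w (2 * π * s)) := by
  set R := ringRadius n
  have hψ : ∀ s, HasDerivAt (fun t => R * (1 - ε * u (2 * π * t)))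
      (R * -(ε * (2 * π * iteratedDeriv 1 u (2 * π * s)))) s := fun s => by
    simpa using (((hasDerivAt_iteratedDeriv_const_mul hu 0 (2 * π) s).const_mul ε).const_sub
      1).const_mul R
  have hψ' : HasDerivAt (fun t => R * -(ε * (2 * π * iteratedDeriv 1 u (2 * π * t))))
      (R * -(ε * (2 * π * (2 * π * iteratedDeriv 2 u (2 * π * s))))) s :=
    ((((hasDerivAt_iteratedDeriv_const_mul hu 1 (2 * π) s).const_mul (2 * π)).const_mul
      ε).neg).const_mul R
  have hφ : ∀ s, HasDerivAt (fun t => 2 * π * t + ε * w (2 * π * t))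
      (2 * π + ε * (2 * π * iteratedDeriv 1 w (2 * π * s))) s := fun s => by
    convert! ((hasDerivAt_id s).const_mul (2 * π)).add
      ((hasDerivAt_iteratedDeriv_const_mul hw 0 (2 * π) s).const_mul ε) using 1
    ring
  have hφ' : HasDerivAt (fun t => 2 * π + ε * (2 * π * iteratedDeriv 1 w (2 * π * t)))
      (ε * (2 * π * (2 * π * iteratedDeriv 2 w (2 * π * s)))) s :=
    (((hasDerivAt_iteratedDeriv_const_mul hw 1 (2 * π) s).const_mul (2 * π)).const_mul
      ε).const_add _
  have hd : ∀ s, HasDerivAt (deformedRing n ε w u)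
      (((R * -(ε * (2 * π * iteratedDeriv 1 u (2 * π * s))) : ℝ)
        + ((R * (1 - ε * u (2 * π * s))) * (2 * π + ε * (2 * π * iteratedDeriv 1 w (2 * π * s))) : ℝ)
          * Complex.I) * Complex.exp ((2 * π * s + ε * w (2 * π * s) : ℝ) * Complex.I)) s := by
    intro s
    rw [deformedRing_eq]
    convert! hasDerivAt_ofReal_mul_exp (hψ s).ofReal_comp (hφ s) using 1
    push_cast
    ring
  have hψφ := (((hψ s).mul hφ').ofReal_comp).mul_const Complex.I
  have hd2 := hasDerivAt_ofReal_mul_exp (hψ'.ofReal_comp.add hψφ) (hφ s)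
  have hder : deriv (deformedRing n ε w u) = _ := funext fun s => (hd s).deriv
  constructor
  · rw [(hd s).deriv, norm_ofReal_add_ofReal_mul_I_mul_exp_sq, speedSq, speedRemainder]
    ring
  · rw [iteratedDeriv_succ, iteratedDeriv_one, hder]
    have e : HasDerivAt (fun s => (((R * -(ε * (2 * π * iteratedDeriv 1 u (2 * π * s))) : ℝ) : ℂ)
        + ((R * (1 - ε * u (2 * π * s))) * (2 * π + ε * (2 * π * iteratedDeriv 1 w (2 * π * s))) : ℝ)
          * Complex.I) * Complex.exp ((2 * π * s + ε * w (2 * π * s) : ℝ) * Complex.I))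
        (((R * (2 * π) ^ 2 * (-(ε * iteratedDeriv 2 u (2 * π * s)) - (1 - ε * u (2 * π * s))
            * (1 + ε * iteratedDeriv 1 w (2 * π * s)) ^ 2) : ℝ)
          + (R * (2 * π) ^ 2 * (-(2 * ε * iteratedDeriv 1 u (2 * π * s)
            * (1 + ε * iteratedDeriv 1 w (2 * π * s))) + (1 - ε * u (2 * π * s))
            * (ε * iteratedDeriv 2 w (2 * π * s))) : ℝ) * Complex.I)
          * Complex.exp ((2 * π * s + ε * w (2 * π * s) : ℝ) * Complex.I)) s := by
      convert! hd2 using 1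
      simp only [Pi.add_apply, Pi.mul_apply]
      push_cast
      ring_nf
      simp only [Complex.I_sq]
      ring
    rw [e.deriv, norm_ofReal_add_ofReal_mul_I_mul_exp_sq, accelSq]
    ring

end Ring

/-! ### Derivatives of the squared speed and the constraints they impose -/

section SpeedDerivatives

variable {U₀ U₁ U₂ U₃ W₁ W₂ W₃ : ℝ → ℝ} {ε c s : ℝ}

theorem hasDerivAt_speedRemainder (h₀ : HasDerivAt U₀ (c * U₁ s) s)
    (h₁ : HasDerivAt U₁ (c * U₂ s) s) (k₁ : HasDerivAt W₁ (c * W₂ s) s) :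
    HasDerivAt (fun s => speedRemainder ε (U₀ s) (U₁ s) (W₁ s))
      (c * speedRemainderDeriv ε (U₀ s) (U₁ s) (U₂ s) (W₁ s) (W₂ s)) s := by
  have h := ((((((h₁.pow 2).add (h₀.pow 2)).add (k₁.pow 2)).sub ((h₀.const_mul 4).mul k₁)).add
    ((((h₀.pow 2).mul k₁).sub (h₀.mul (k₁.pow 2))).const_mul (2 * ε))).add
    (((h₀.pow 2).const_mul (ε ^ 2)).mul (k₁.pow 2)))
  refine h.congr_deriv ?_
  simp only [speedRemainderDeriv, Pi.pow_apply, Nat.cast_ofNat, Nat.add_one_sub_one, pow_one]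
  ring

theorem hasDerivAt_speedRemainderDeriv (h₀ : HasDerivAt U₀ (c * U₁ s) s)
    (h₁ : HasDerivAt U₁ (c * U₂ s) s) (h₂ : HasDerivAt U₂ (c * U₃ s) s)
    (k₁ : HasDerivAt W₁ (c * W₂ s) s) (k₂ : HasDerivAt W₂ (c * W₃ s) s) :
    HasDerivAt (fun s => speedRemainderDeriv ε (U₀ s) (U₁ s) (U₂ s) (W₁ s) (W₂ s))
      (c * speedRemainderDerivTwo ε (U₀ s) (U₁ s) (U₂ s) (U₃ s) (W₁ s) (W₂ s) (W₃ s)) s := by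
  have h := ((((((h₁.const_mul 2).mul h₂).add ((h₀.const_mul 2).mul h₁)).add
      ((k₁.const_mul 2).mul k₂)).sub ((h₁.const_mul 4).mul k₁)).sub ((h₀.const_mul 4).mul k₂)).add
    ((((((h₀.const_mul 2).mul h₁).mul k₁).add ((h₀.pow 2).mul k₂)).sub (h₁.mul (k₁.pow 2))).sub
      (((h₀.const_mul 2).mul k₁).mul k₂) |>.const_mul (2 * ε)) |>.add
    (((((h₀.const_mul 2).mul h₁).mul (k₁.pow 2)).add
      ((((h₀.pow 2).const_mul 2).mul k₁).mul k₂)).const_mul (ε ^ 2))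
  refine h.congr_deriv ?_
  simp only [speedRemainderDerivTwo, Pi.pow_apply, Pi.mul_apply, Nat.cast_ofNat,
    Nat.add_one_sub_one, pow_one]
  ring

theorem hasDerivAt_speedSq (h₀ : HasDerivAt U₀ (c * U₁ s) s)
    (h₁ : HasDerivAt U₁ (c * U₂ s) s) (k₁ : HasDerivAt W₁ (c * W₂ s) s) :
    HasDerivAt (fun s => speedSq ε (U₀ s) (U₁ s) (W₁ s))
      (c * (-2 * ε * (U₁ s - W₂ s)
        + ε ^ 2 * speedRemainderDeriv ε (U₀ s) (U₁ s) (U₂ s) (W₁ s) (W₂ s))) s := by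
  have h := (((h₀.sub k₁).const_mul (2 * ε)).const_sub 1).add
    ((hasDerivAt_speedRemainder (ε := ε) h₀ h₁ k₁).const_mul (ε ^ 2))
  refine h.congr_deriv ?_
  ring

theorem hasDerivAt_speedSq_deriv (h₀ : HasDerivAt U₀ (c * U₁ s) s)
    (h₁ : HasDerivAt U₁ (c * U₂ s) s) (h₂ : HasDerivAt U₂ (c * U₃ s) s)
    (k₁ : HasDerivAt W₁ (c * W₂ s) s) (k₂ : HasDerivAt W₂ (c * W₃ s) s) :
    HasDerivAt (fun s => -2 * ε * (U₁ s - W₂ s)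
        + ε ^ 2 * speedRemainderDeriv ε (U₀ s) (U₁ s) (U₂ s) (W₁ s) (W₂ s))
      (c * (-2 * ε * (U₂ s - W₃ s) + ε ^ 2 *
        speedRemainderDerivTwo ε (U₀ s) (U₁ s) (U₂ s) (U₃ s) (W₁ s) (W₂ s) (W₃ s))) s := by
  have h := ((h₁.sub k₂).const_mul (-2 * ε)).add
    ((hasDerivAt_speedRemainderDeriv (ε := ε) h₀ h₁ h₂ k₁ k₂).const_mul (ε ^ 2))
  refine h.congr_deriv ?_
  ring

end SpeedDerivatives

theorem abs_le_of_mul_eq {a c x b : ℝ} (hc : (1 : ℝ) ≤ c) (h : c * a = x) (hx : |x| ≤ b) : |a| ≤ b := by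
  refine le_trans ?_ hx
  rw [← h, abs_mul, abs_of_pos (zero_lt_one.trans_le hc)]
  exact le_mul_of_one_le_left (abs_nonneg a) hc

theorem IsBoundedDisplacement.mono {K K' : ℝ} (hK : K ≤ K') {w u : ℝ → ℝ}
    (h : IsBoundedDisplacement K w u) : IsBoundedDisplacement K' w u := by
  obtain ⟨h1, h2, h3, h4, h5, h6⟩ := h
  exact ⟨h1, h2, h3, h4, fun j hj θ => (h5 j hj θ).trans hK, fun j hj θ => (h6 j hj θ).trans hK⟩

theorem Function.Periodic.iteratedDeriv_eq {f : ℝ → ℝ} {c : ℝ} (hf : Function.Periodic f c) (j : ℕ) :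
    Function.Periodic (iteratedDeriv j f) c := fun x => by
  have h := congrFun (iteratedDeriv_comp_add_const j f c) x
  rw [show (fun z => f (z + c)) = f from funext hf] at h
  exact h.symm

/-- Constraints that near inextensibility imposes on the displacements. -/
theorem speedSq_bounds {K : ℝ} (hK : 1 ≤ K) {n : ℕ} {ε : ℝ} {w u : ℝ → ℝ} (hn : 4 ≤ n)
    (hε : 0 < ε) (ht : K * (ε ^ 3 + 1 / (n : ℝ) ^ 2) ≤ 1 / 2) (hw : ContDiff ℝ ∞ w)
    (hu : ContDiff ℝ ∞ u)
    (hi : IsInextensibleUpTo (K * (ε ^ 3 + 1 / (n : ℝ) ^ 2)) (deformedRing n ε w u)) (s : ℝ) :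
    |speedSq ε (u (2 * π * s)) (iteratedDeriv 1 u (2 * π * s)) (iteratedDeriv 1 w (2 * π * s)) - 1|
      ≤ 10 * K * (ε ^ 3 + 1 / (n : ℝ) ^ 2) ∧
    |-2 * ε * (iteratedDeriv 1 u (2 * π * s) - iteratedDeriv 2 w (2 * π * s)) + ε ^ 2 *
      speedRemainderDeriv ε (u (2 * π * s)) (iteratedDeriv 1 u (2 * π * s))
        (iteratedDeriv 2 u (2 * π * s)) (iteratedDeriv 1 w (2 * π * s))
        (iteratedDeriv 2 w (2 * π * s))| ≤ 10 * K * (ε ^ 3 + 1 / (n : ℝ) ^ 2) ∧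
    |-2 * ε * (iteratedDeriv 2 u (2 * π * s) - iteratedDeriv 3 w (2 * π * s)) + ε ^ 2 *
      speedRemainderDerivTwo ε (u (2 * π * s)) (iteratedDeriv 1 u (2 * π * s))
        (iteratedDeriv 2 u (2 * π * s)) (iteratedDeriv 3 u (2 * π * s))
        (iteratedDeriv 1 w (2 * π * s)) (iteratedDeriv 2 w (2 * π * s))
        (iteratedDeriv 3 w (2 * π * s))| ≤ 10 * K * (ε ^ 3 + 1 / (n : ℝ) ^ 2) := by
  obtain ⟨hρ1, hρ2⟩ := ringRadius_bounds hn
  set ρ := 2 * π * ringRadius n with hρ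
  set t : ℝ := ε ^ 3 + 1 / (n : ℝ) ^ 2 with htdef
  have hnt : 1 / (n : ℝ) ^ 2 ≤ t := by rw [htdef]; linarith [pow_pos hε 3]
  have ht0 : 0 ≤ t := le_trans (by positivity) hnt
  have htK : t ≤ K * t := le_mul_of_one_le_left ht0 hK
  have hv := hi.speed_bounds ht
  have hvs : ContDiff ℝ ∞ (fun t => ‖deriv (deformedRing n ε w u) t‖) :=
    (contDiff_infty_iff_deriv.1 (contDiff_deformedRing hw hu)).2.norm ℝ fun s => (hv s).1
  have d1 : ∀ x, HasDerivAt (fun t => ‖deriv (deformedRing n ε w u) t‖)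
      (deriv (fun t => ‖deriv (deformedRing n ε w u) t‖) x) x := fun x => by
    simpa using hasDerivAt_iteratedDeriv hvs 0 x
  have d2 : HasDerivAt (deriv fun t => ‖deriv (deformedRing n ε w u) t‖)
      (iteratedDeriv 2 (fun t => ‖deriv (deformedRing n ε w u) t‖) s) s := by
    simpa using hasDerivAt_iteratedDeriv hvs 1 s
  have hsq := fun x => (norm_deriv_deformedRing_sq (n := n) (ε := ε) hw hu x).1
  have U := fun j x => hasDerivAt_iteratedDeriv_const_mul hu j (2 * π) x
  have W := fun j x => hasDerivAt_iteratedDeriv_const_mul hw j (2 * π) x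
  have U0 : ∀ x, HasDerivAt (fun t => u (2 * π * t)) (2 * π * iteratedDeriv 1 u (2 * π * x)) x :=
    fun x => by simpa using U 0 x
  let D : (ℝ → ℝ) → ℕ → ℝ → ℝ := fun f j x => iteratedDeriv j f (2 * π * x)
  obtain ⟨-, b0, b1, b2⟩ := hv s
  generalize hV : (fun t => ‖deriv (deformedRing n ε w u) t‖) = V at *
  have hVs : ∀ x, ‖deriv (deformedRing n ε w u) x‖ = V x := fun x => congrFun hV x
  simp only [hVs] at hsq b0
  -- The identity V² = ρ² `speedSq` is differentiated here, and once more in `e2`, so bounds on V -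
  -- 1, V' and V'' pass to the displacements.
  have e1 : ∀ x, ρ ^ 2 * (2 * π) * (-2 * ε * (iteratedDeriv 1 u (2 * π * x)
      - iteratedDeriv 2 w (2 * π * x)) + ε ^ 2 * speedRemainderDeriv ε (u (2 * π * x))
        (iteratedDeriv 1 u (2 * π * x)) (iteratedDeriv 2 u (2 * π * x))
        (iteratedDeriv 1 w (2 * π * x)) (iteratedDeriv 2 w (2 * π * x)))
      = 2 * V x * deriv V x := by
    intro x
    have h1 := (d1 x).pow 2
    rw [show V ^ 2 = fun t => ρ ^ 2 * speedSq ε (u (2 * π * t)) (iteratedDeriv 1 u (2 * π * t))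
      (iteratedDeriv 1 w (2 * π * t)) from funext hsq] at h1
    have h2 := ((hasDerivAt_speedSq (ε := ε) (U₂ := D u 2) (W₂ := D w 2) (U0 x) (U 1 x)
      (W 1 x)).const_mul (ρ ^ 2)).unique h1
    simp only [Nat.cast_ofNat, Nat.add_one_sub_one, pow_one] at h2
    linarith
  have e2 := ((hasDerivAt_speedSq_deriv (ε := ε) (U₃ := D u 3) (W₃ := D w 3) (U0 s) (U 1 s) (U 2 s) (W 1 s) (W 2 s)).const_mul
    (ρ ^ 2 * (2 * π))).unique (by
      have h1 := ((d1 s).const_mul 2).mul d2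
      rw [show (fun x => 2 * V x) * deriv V = _ from funext fun x => (e1 x).symm] at h1
      exact h1)
  have hρsq : 1 ≤ ρ ^ 2 := one_le_pow₀ hρ1
  have hπ : 1 ≤ 2 * π := by linarith [Real.pi_gt_three]
  have hρπ : 1 ≤ ρ ^ 2 * (2 * π) := one_le_mul_of_one_le_of_one_le hρsq hπ
  obtain ⟨b0l, b0r⟩ := abs_le.1 b0
  have hV0 : |V s| ≤ 3 / 2 := abs_le.2 ⟨by linarith, by linarith⟩
  -- The factors ρ² and 2π are at least one and can be dropped. In the first bound ρ²(`speedSq` - 1)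
  -- = (V² - 1) - (ρ² - 1), so the radius adds its own O(n⁻²) error.
  refine ⟨abs_le_of_mul_eq hρsq (x := (V s - 1) * (V s + 1) - (ρ - 1) * (ρ + 1))
      (by linear_combination -(hsq s)) ?_, abs_le_of_mul_eq hρπ (e1 s) ?_,
    abs_le_of_mul_eq (one_le_mul_of_one_le_of_one_le hρπ hπ) ((mul_assoc _ _ _).trans e2) ?_⟩
  · have h1 : |(V s - 1) * (V s + 1)| ≤ K * t * (5 / 2) := by
      rw [abs_mul]
      gcongr
      exact abs_le.2 ⟨by linarith, by linarith⟩
    have h2 : |(ρ - 1) * (ρ + 1)| ≤ 2 * t * 3 := by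
      rw [abs_mul, abs_of_nonneg (by linarith : 0 ≤ ρ - 1), abs_of_nonneg (by linarith : 0 ≤ ρ + 1)]
      gcongr <;> linarith
    have := abs_sub ((V s - 1) * (V s + 1)) ((ρ - 1) * (ρ + 1))
    linarith
  · rw [abs_mul, abs_mul, abs_two]
    calc 2 * |V s| * |deriv V s| ≤ 2 * (3 / 2) * (K * t) := by gcongr
      _ ≤ _ := by linarith
  · have h1 : |2 * deriv V s * deriv V s| ≤ 2 * (1 / 2) * (K * t) := by
      rw [abs_mul, abs_mul, abs_two]
      gcongr
      exact b1.trans ht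
    have h2 : |2 * V s * iteratedDeriv 2 V s| ≤ 2 * (3 / 2) * (K * t) := by
      rw [abs_mul, abs_mul, abs_two]
      gcongr
    refine (abs_add_le _ _).trans ?_
    linarith

/-! ### The deformed ring is a closed simple curve -/

theorem deformedRing_one_eq_zero {n : ℕ} {ε : ℝ} {w u : ℝ → ℝ} (hw : Function.Periodic w (2 * π))
    (hu : Function.Periodic u (2 * π)) : deformedRing n ε w u 1 = deformedRing n ε w u 0 := by
  have h1 : w (2 * π) = w 0 := by simpa using hw 0
  have h2 : u (2 * π) = u 0 := by simpa using hu 0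
  simp only [deformedRing, mul_one, mul_zero, zero_add, h1, h2]
  rw [add_comm (2 * π), Real.cos_add_two_pi, Real.sin_add_two_pi]

/-- Since εK < 1, the radius is positive and the polar angle φ is strictly increasing, with total
increase 2π. Coinciding points have angles that differ by a multiple of 2π. -/
theorem deformedRing_ne {n : ℕ} {ε K : ℝ} {w u : ℝ → ℝ} (hR : 0 < ringRadius n) (hε : 0 < ε)
    (hεK : ε * K < 1) (h : IsBoundedDisplacement K w u) :
    ∀ s ∈ Ioo (0 : ℝ) 1, ∀ η ∈ Icc (0 : ℝ) 1, η ≠ s →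
      deformedRing n ε w u η ≠ deformedRing n ε w u s := by
  obtain ⟨hw, hu, hwp, hup, hwK, huK⟩ := h
  intro s hs η hη hne heq
  set φ : ℝ → ℝ := fun s => 2 * π * s + ε * w (2 * π * s) with hφ
  have hd : ∀ x, HasDerivAt φ (2 * π + ε * (2 * π * iteratedDeriv 1 w (2 * π * x))) x := fun x => by
    convert! ((hasDerivAt_id x).const_mul (2 * π)).add
      ((hasDerivAt_iteratedDeriv_const_mul hw 0 (2 * π) x).const_mul ε) using 1
    ring
  have hmono : StrictMono φ := by
    refine strictMono_of_deriv_pos fun x => ?_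
    rw [(hd x).deriv]
    have h1 := (abs_le.1 (hwK 1 (by norm_num) (2 * π * x))).1
    have h2 : ε * -K ≤ ε * iteratedDeriv 1 w (2 * π * x) := by gcongr
    have : 0 < 2 * π * (1 + ε * iteratedDeriv 1 w (2 * π * x)) := by
      apply mul_pos (by positivity)
      linarith
    linarith
  have hφ1 : φ 1 = φ 0 + 2 * π := by
    have h1 : w (2 * π) = w 0 := by simpa using hwp 0
    simp only [hφ, mul_one, mul_zero, h1]
    ring
  have hpos : ∀ x, 0 < ringRadius n * (1 - ε * u (2 * π * x)) := fun x => by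
    have h1 := (abs_le.1 (huK 0 (by norm_num) (2 * π * x))).2
    rw [iteratedDeriv_zero] at h1
    have h2 : ε * u (2 * π * x) ≤ ε * K := by gcongr
    exact mul_pos hR (by linarith)
  simp only [deformedRing_eq] at heq
  have hnorm := congrArg (‖·‖) heq
  simp only [norm_mul, Complex.norm_exp_ofReal_mul_I, mul_one, Complex.norm_real,
    Real.norm_of_nonneg (hpos _).le] at hnorm
  rw [hnorm] at heq
  have hexp := mul_left_cancel₀ (Complex.ofReal_ne_zero.2 (hpos s).ne') heq
  obtain ⟨k, hk⟩ := Complex.exp_eq_exp_iff_exists_int.1 hexp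
  have hk' : φ η = φ s + k * (2 * π) := by
    have h1 : ((φ η : ℝ) : ℂ) * Complex.I = ((φ s + k * (2 * π) : ℝ) : ℂ) * Complex.I := by
      rw [hφ, hk]
      push_cast
      ring
    exact Complex.ofReal_injective (mul_right_cancel₀ Complex.I_ne_zero h1)
  have a1 := hmono hs.1
  have a2 := hmono hs.2
  have a3 := hmono.monotone hη.1
  have a4 := hmono.monotone hη.2
  -- As s is interior, φ(0) < φ(s) < φ(1), so φ(η) and φ(s) differ by less than a full turn even if
  -- η is 0 or 1.
  have hkl : (-1 : ℝ) < k := by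
    by_contra! hcon
    have : (k : ℝ) * (2 * π) ≤ -1 * (2 * π) := by gcongr
    linarith
  have hkr : (k : ℝ) < 1 := by
    by_contra! hcon
    have : 1 * (2 * π) ≤ (k : ℝ) * (2 * π) := by gcongr
    linarith
  have hk0 : k = 0 := by
    have h1 : -1 < k := by exact_mod_cast hkl
    have h2 : k < 1 := by exact_mod_cast hkr
    omega
  rw [hk0, Int.cast_zero, zero_mul, add_zero] at hk'
  exact hne (hmono.injective hk')

/-! ### Expansion of the local energy -/

/-- Up to the factor 1/(2π), the integrand is the s-derivative of the periodic function 2εu' + 2εw +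
2ε²w''w', evaluated at 2πs. -/
theorem integral_exact_part {ε : ℝ} {w u : ℝ → ℝ} (hw : ContDiff ℝ ∞ w) (hu : ContDiff ℝ ∞ u)
    (hwp : Function.Periodic w (2 * π)) (hup : Function.Periodic u (2 * π)) :
    ∫ s in (0 : ℝ)..1, (2 * ε * iteratedDeriv 2 u (2 * π * s) + 2 * ε * iteratedDeriv 1 w (2 * π * s)
      + 2 * ε ^ 2 * (iteratedDeriv 3 w (2 * π * s) * iteratedDeriv 1 w (2 * π * s)
        + iteratedDeriv 2 w (2 * π * s) ^ 2)) = 0 := by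
  have U := fun j x => hasDerivAt_iteratedDeriv_const_mul hu j (2 * π) x
  have W := fun j x => hasDerivAt_iteratedDeriv_const_mul hw j (2 * π) x
  have hper : ∀ {f : ℝ → ℝ}, Function.Periodic f (2 * π) → ∀ j,
      iteratedDeriv j f (2 * π * 1) = iteratedDeriv j f (2 * π * 0) := fun hf j => by
    simpa using hf.iteratedDeriv_eq j 0
  have cU := fun j => continuous_iteratedDeriv_of_smooth hu j
  have cW := fun j => continuous_iteratedDeriv_of_smooth hw j
  rw [intervalIntegral.integral_eq_sub_of_hasDerivAt (f := fun s => (2 * π)⁻¹ *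
    (2 * ε * iteratedDeriv 1 u (2 * π * s) + 2 * ε * iteratedDeriv 0 w (2 * π * s)
      + 2 * ε ^ 2 * (iteratedDeriv 2 w (2 * π * s) * iteratedDeriv 1 w (2 * π * s))))]
  · simp only [hper hwp, hper hup, sub_self]
  · intro s _
    have h := ((((U 1 s).const_mul (2 * ε)).add ((W 0 s).const_mul (2 * ε))).add
      (((W 2 s).mul (W 1 s)).const_mul (2 * ε ^ 2))).const_mul (2 * π)⁻¹
    refine h.congr_deriv ?_
    norm_num
    field_simp
  · refine Continuous.intervalIntegrable ?_ 0 1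
    have := cU 2
    have := cW 1
    have := cW 2
    have := cW 3
    fun_prop

theorem integral_bending_density {w : ℝ → ℝ} :
    ∫ s in (0 : ℝ)..1, (iteratedDeriv 1 w (2 * π * s) ^ 2 - 2 * iteratedDeriv 2 w (2 * π * s) ^ 2
      + iteratedDeriv 3 w (2 * π * s) ^ 2) = (2 * π)⁻¹ * bendingForm w := by
  rw [intervalIntegral.integral_comp_mul_left (fun θ => iteratedDeriv 1 w θ ^ 2
    - 2 * iteratedDeriv 2 w θ ^ 2 + iteratedDeriv 3 w θ ^ 2) (by positivity), bendingForm]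
  simp

theorem abs_bendingForm_le {K : ℝ} {w u : ℝ → ℝ} (h : IsBoundedDisplacement K w u) :
    |bendingForm w| ≤ 4 * K ^ 2 * (2 * π) := by
  have h1 := intervalIntegral.norm_integral_le_of_norm_le_const (a := 0) (b := 2 * π)
    (C := 4 * K ^ 2) (f := fun θ => deriv w θ ^ 2 - 2 * iteratedDeriv 2 w θ ^ 2
      + iteratedDeriv 3 w θ ^ 2) (fun θ _ => by
    have hb : ∀ j ≤ 7, iteratedDeriv j w θ ^ 2 ≤ K ^ 2 := fun j hj => by
      rw [← sq_abs]
      exact pow_le_pow_left₀ (abs_nonneg _) (h.2.2.2.2.1 j hj θ) 2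
    have b1 := hb 1 (by norm_num)
    have b2 := hb 2 (by norm_num)
    have b3 := hb 3 (by norm_num)
    rw [iteratedDeriv_one] at b1
    rw [Real.norm_eq_abs, abs_le]
    constructor <;> nlinarith [sq_nonneg (deriv w θ), sq_nonneg (iteratedDeriv 2 w θ),
      sq_nonneg (iteratedDeriv 3 w θ)])
  simpa [bendingForm, abs_of_pos Real.pi_pos] using h1

/-- Expansion of the local energy, and a bound for the curvature. -/
theorem exists_localEnergy_bound {K : ℝ} (hK : 1 ≤ K) :
    ∃ C, 0 ≤ C ∧ ∀ (n : ℕ) (ε : ℝ) (w u : ℝ → ℝ), 4 ≤ n → 0 < ε → ε ≤ 1 →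
      K * (ε ^ 3 + 1 / (n : ℝ) ^ 2) ≤ 1 / 2 → IsBoundedDisplacement K w u →
      IsInextensibleUpTo (K * (ε ^ 3 + 1 / (n : ℝ) ^ 2)) (deformedRing n ε w u) →
      (∀ s, ‖iteratedDeriv 2 (deformedRing n ε w u) s‖ ^ 2 ≤ C) ∧
      |localEnergy (deformedRing n ε w u) - (4 * π ^ 2 + 2 * π * ε ^ 2 * bendingForm w)|
        ≤ C * (ε ^ 3 + 1 / (n : ℝ) ^ 2) := by
  obtain ⟨A, hA0, hA⟩ := exists_jet_bound
    (fun ε u₀ u₁ u₂ _ w₁ w₂ _ => accelSq ε u₀ u₁ u₂ w₁ w₂)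
    (by simp only [accelSq]; fun_prop) K
  obtain ⟨B, hB0, hB⟩ := exists_accelSq_bound hK (10 * K)
  -- One constant serves both claims: the summand with A bounds the curvature, the others bound the
  -- energy error. The factor 2² comes from ρ ≤ 2.
  refine ⟨(2 * π) ^ 2 * 2 ^ 2 * A + (6 * (4 * π ^ 2 + 2 * π * (4 * K ^ 2 * (2 * π)))
    + (2 * π) ^ 2 * 2 ^ 2 * B), by positivity, ?_⟩
  intro n ε w u hn hε hε1 ht hb hi
  have hb' := hb
  obtain ⟨hw, hu, hwp, hup, hwK, huK⟩ := hb'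
  obtain ⟨hρ1, hρ2⟩ := ringRadius_bounds hn
  have hsq := fun x => (norm_deriv_deformedRing_sq (n := n) (ε := ε) hw hu x).2
  have hsp := speedSq_bounds hK hn hε ht hw hu hi
  set ρ := 2 * π * ringRadius n with hρ
  set t : ℝ := ε ^ 3 + 1 / (n : ℝ) ^ 2 with htdef
  have hn2 : 0 ≤ 1 / (n : ℝ) ^ 2 := by positivity
  have hnt : 1 / (n : ℝ) ^ 2 ≤ t := by rw [htdef]; linarith [pow_pos hε 3]
  have hεt : ε ^ 3 ≤ t := by rw [htdef]; linarith
  have ht0 : 0 ≤ t := hn2.trans hnt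
  have htK : t ≤ K * t := le_mul_of_one_le_left ht0 hK
  have hρ0 : 0 ≤ ρ := by linarith
  have hρle : ρ ≤ 2 := by linarith
  have hεK : |ε| ≤ K := by rw [abs_of_pos hε]; linarith
  have hu0 : ∀ x, |u x| ≤ K := fun x => by simpa using huK 0 (by norm_num) x
  constructor
  · intro s
    rw [hsq s]
    have := (le_abs_self _).trans (hA ε _ _ _ (iteratedDeriv 3 u (2 * π * s)) _ _
      (iteratedDeriv 3 w (2 * π * s)) hεK (hu0 (2 * π * s))
      (huK 1 (by norm_num) (2 * π * s)) (huK 2 (by norm_num) (2 * π * s)) (huK 3 (by norm_num) _)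
      (hwK 1 (by norm_num) (2 * π * s)) (hwK 2 (by norm_num) (2 * π * s)) (hwK 3 (by norm_num) _))
    calc (2 * π) ^ 2 * ρ ^ 2 * _ ≤ (2 * π) ^ 2 * ρ ^ 2 * A :=
          mul_le_mul_of_nonneg_left this (by positivity)
      _ ≤ (2 * π) ^ 2 * 2 ^ 2 * A := by gcongr
      _ ≤ _ := le_add_of_nonneg_right (by positivity)
  · set a : ℝ → ℝ := fun s => accelSq ε (u (2 * π * s)) (iteratedDeriv 1 u (2 * π * s))
      (iteratedDeriv 2 u (2 * π * s)) (iteratedDeriv 1 w (2 * π * s))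
      (iteratedDeriv 2 w (2 * π * s)) with ha
    set J : ℝ → ℝ := fun s => iteratedDeriv 1 w (2 * π * s) ^ 2
      - 2 * iteratedDeriv 2 w (2 * π * s) ^ 2 + iteratedDeriv 3 w (2 * π * s) ^ 2 with hJ
    set T : ℝ → ℝ := fun s => 2 * ε * iteratedDeriv 2 u (2 * π * s)
      + 2 * ε * iteratedDeriv 1 w (2 * π * s)
      + 2 * ε ^ 2 * (iteratedDeriv 3 w (2 * π * s) * iteratedDeriv 1 w (2 * π * s)
        + iteratedDeriv 2 w (2 * π * s) ^ 2) with hT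
    have cu := hu.continuous
    have cu1 := continuous_iteratedDeriv_of_smooth hu 1
    have cu2 := continuous_iteratedDeriv_of_smooth hu 2
    have cw1 := continuous_iteratedDeriv_of_smooth hw 1
    have cw2 := continuous_iteratedDeriv_of_smooth hw 2
    have cw3 := continuous_iteratedDeriv_of_smooth hw 3
    have ca : Continuous a := by simp only [ha, accelSq]; fun_prop
    have cJ : Continuous J := by simp only [hJ]; fun_prop
    have cT : Continuous T := by simp only [hT]; fun_prop
    have hpt : ∀ s, |a s - (1 + ε ^ 2 * J s + T s)| ≤ B * t := fun s => by
      obtain ⟨h0, h1, h2⟩ := hsp s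
      exact hB ε t _ _ _ _ _ _ _ hε hε1 hεt (hu0 (2 * π * s)) (huK 1 (by norm_num) (2 * π * s))
        (huK 2 (by norm_num) (2 * π * s)) (huK 3 (by norm_num) (2 * π * s))
        (hwK 1 (by norm_num) (2 * π * s)) (hwK 2 (by norm_num) (2 * π * s))
        (hwK 3 (by norm_num) (2 * π * s)) h0 h1 h2
    have hint : |(∫ s in (0 : ℝ)..1, a s) - (1 + ε ^ 2 * ((2 * π)⁻¹ * bendingForm w))|
        ≤ B * t := by
      have e : ∫ s in (0 : ℝ)..1, (1 + ε ^ 2 * J s + T s)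
          = 1 + ε ^ 2 * ((2 * π)⁻¹ * bendingForm w) := by
        rw [intervalIntegral.integral_add ((by fun_prop : Continuous fun s =>
            1 + ε ^ 2 * J s).intervalIntegrable 0 1) (cT.intervalIntegrable 0 1),
          intervalIntegral.integral_add (continuous_const.intervalIntegrable 0 1)
            ((cJ.const_mul _).intervalIntegrable 0 1),
          intervalIntegral.integral_const_mul, integral_bending_density,
          integral_exact_part hw hu hwp hup]
        simp
      rw [← e, ← intervalIntegral.integral_sub (ca.intervalIntegrable 0 1)
        ((by fun_prop : Continuous fun s => 1 + ε ^ 2 * J s + T s).intervalIntegrable 0 1)]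
      have h := intervalIntegral.norm_integral_le_of_norm_le_const (a := 0) (b := 1) (C := B * t)
        (f := fun s => a s - (1 + ε ^ 2 * J s + T s)) (fun s _ => hpt s)
      rw [sub_zero, abs_one, mul_one] at h
      exact h
    have hE : localEnergy (deformedRing n ε w u)
        = (2 * π) ^ 2 * ρ ^ 2 * ∫ s in (0 : ℝ)..1, a s := by
      rw [localEnergy, ← intervalIntegral.integral_const_mul]
      simp only [hsq, ha]
    have hI := abs_bendingForm_le hb
    -- Separates the error of the radius, ρ² - 1 = O(n⁻²), from the error of the integrated
    -- expansion.
    have e : (2 * π) ^ 2 * ρ ^ 2 * (∫ s in (0 : ℝ)..1, a s)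
        - (4 * π ^ 2 + 2 * π * ε ^ 2 * bendingForm w)
        = (ρ ^ 2 - 1) * (4 * π ^ 2 + 2 * π * ε ^ 2 * bendingForm w) + (2 * π) ^ 2 * ρ ^ 2 *
          ((∫ s in (0 : ℝ)..1, a s) - (1 + ε ^ 2 * ((2 * π)⁻¹ * bendingForm w))) := by
      field_simp
      ring
    have b1 : |4 * π ^ 2 + 2 * π * ε ^ 2 * bendingForm w|
        ≤ 4 * π ^ 2 + 2 * π * (4 * K ^ 2 * (2 * π)) := by
      refine (abs_add_le _ _).trans ?_
      rw [abs_of_pos (by positivity), abs_mul, abs_of_pos (by positivity : 0 < 2 * π * ε ^ 2)]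
      have : 2 * π * ε ^ 2 ≤ 2 * π * 1 := by
        gcongr
        exact pow_le_one₀ hε.le hε1
      rw [mul_one] at this
      gcongr
    have b2 : |ρ ^ 2 - 1| ≤ 6 * t := by
      rw [abs_of_nonneg (by nlinarith)]
      nlinarith
    rw [hE, e]
    calc _ ≤ 6 * t * (4 * π ^ 2 + 2 * π * (4 * K ^ 2 * (2 * π))) + (2 * π) ^ 2 * 2 ^ 2 * (B * t) := by
          refine (abs_add_le _ _).trans (add_le_add ?_ ?_)
          · rw [abs_mul]
            gcongr
          · rw [abs_mul, abs_of_nonneg (by positivity : 0 ≤ (2 * π) ^ 2 * ρ ^ 2)]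
            gcongr
      _ ≤ _ := by
          have : 0 ≤ (2 * π) ^ 2 * 2 ^ 2 * A * t := by positivity
          linarith

/-! ### Choice of constants and conclusion -/

theorem exists_energy_bound {K : ℝ} (hK : 1 ≤ K) :
    ∃ (C ε₀ : ℝ) (n₀ : ℕ), 0 < ε₀ ∧
      ∀ (n : ℕ) (ε : ℝ) (w u : ℝ → ℝ), n₀ ≤ n → 0 < ε → ε ≤ ε₀ →
        IsBoundedDisplacement K w u →
        IsInextensibleUpTo (K * (ε ^ 3 + 1 / (n : ℝ) ^ 2)) (deformedRing n ε w u) →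
        (∀ s ∈ Ioo (0 : ℝ) 1,
          ∃ v, IsFinitePart (dipoleDensity (deformedRing n ε w u) s) 0 1 s v) ∧
        IntervalIntegrable
          (fun s => finitePart (dipoleDensity (deformedRing n ε w u) s) 0 1 s) volume 0 1 ∧
        |localEnergy (deformedRing n ε w u)
            - (4 * π ^ 2 + 2 * π * ε ^ 2 * bendingForm w)| ≤ C * (ε ^ 3 + 1 / (n : ℝ) ^ 2) ∧
        |nonlocalEnergy (deformedRing n ε w u) - 1 / 12 * localEnergy (deformedRing n ε w u)|
          ≤ C * (ε ^ 3 + 1 / (n : ℝ) ^ 2) := by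
  obtain ⟨C, hC, h⟩ := exists_localEnergy_bound hK
  have hK0 : 0 < K := by linarith
  -- These thresholds make Kε³ and K/n² at most 1/4 each, so the speed error is at most 1/2, and
  -- they give εK < 1. The summand (4C + 16)K arises from the curvature bound C and the speed error
  -- K(ε³ + n⁻²).
  refine ⟨C + (4 * C + 16) * K, 1 / (4 * K), max 4 ⌈4 * K⌉₊, by positivity, ?_⟩
  intro n ε w u hn hε hε1 hb hi
  have hn4 : 4 ≤ n := (le_max_left _ _).trans hn
  have hn4' : (4 : ℝ) ≤ n := by exact_mod_cast hn4
  have hnK : 4 * K ≤ n := (Nat.le_ceil _).trans (by exact_mod_cast (le_max_right _ _).trans hn)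
  have hεK : ε * K ≤ 1 / 4 := by
    rw [le_div_iff₀ (by positivity)] at hε1
    linarith
  have hε4 : ε ≤ 1 / 4 := by nlinarith
  have ht : K * (ε ^ 3 + 1 / (n : ℝ) ^ 2) ≤ 1 / 2 := by
    have h1 : K * ε ^ 3 ≤ 1 / 4 := by
      have : ε ^ 2 ≤ 1 := by nlinarith
      calc K * ε ^ 3 = ε * K * ε ^ 2 := by ring
        _ ≤ 1 / 4 * 1 := by gcongr
        _ = 1 / 4 := by norm_num
    have h2 : K * (1 / (n : ℝ) ^ 2) ≤ 1 / 4 := by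
      rw [mul_one_div, div_le_iff₀ (by positivity)]
      nlinarith
    linarith
  obtain ⟨hM, hE⟩ := h n ε w u hn4 hε (by linarith) ht hb hi
  have hR : 0 < ringRadius n := by
    have h1 := (ringRadius_bounds hn4).1
    by_contra! hcon
    have := mul_nonpos_of_nonneg_of_nonpos (by positivity : 0 ≤ 2 * π) hcon
    linarith
  obtain ⟨h1, h2, h3⟩ := nonlocalEnergy_sub_localEnergy (contDiff_deformedRing hb.1 hb.2.1)
    (deformedRing_one_eq_zero hb.2.2.1 hb.2.2.2.1)
    (deformedRing_ne hR hε (by linarith) hb) ht hi hM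
  have ht0 : 0 ≤ ε ^ 3 + 1 / (n : ℝ) ^ 2 := by positivity
  refine ⟨h1, h2, hE.trans ?_, h3.trans ?_⟩
  · gcongr
    exact le_add_of_nonneg_right (by positivity)
  · rw [← mul_assoc]
    gcongr
    exact le_add_of_nonneg_left hC

theorem mainTheorem4 (K : ℝ) :
    ∃ (C ε₀ : ℝ) (n₀ : ℕ), 0 < ε₀ ∧
      ∀ (n : ℕ) (ε : ℝ) (w u : ℝ → ℝ), n₀ ≤ n → 0 < ε → ε ≤ ε₀ →
        IsBoundedDisplacement K w u →
        IsInextensibleUpTo (K * (ε ^ 3 + 1 / (n : ℝ) ^ 2)) (deformedRing n ε w u) →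
        (∀ s ∈ Ioo (0 : ℝ) 1,
          ∃ v, IsFinitePart (dipoleDensity (deformedRing n ε w u) s) 0 1 s v) ∧
        IntervalIntegrable
          (fun s => finitePart (dipoleDensity (deformedRing n ε w u) s) 0 1 s) volume 0 1 ∧
        |localEnergy (deformedRing n ε w u)
            - (4 * π ^ 2 + 2 * π * ε ^ 2 * bendingForm w)| ≤ C * (ε ^ 3 + 1 / (n : ℝ) ^ 2) ∧
        |nonlocalEnergy (deformedRing n ε w u)
            - (π ^ 2 / 3 + ε ^ 2 * π / 6 * bendingForm w)| ≤ C * (ε ^ 3 + 1 / (n : ℝ) ^ 2) ∧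
        |nonlocalEnergy (deformedRing n ε w u)
            - 1 / 12 * localEnergy (deformedRing n ε w u)| ≤ C * (ε ^ 3 + 1 / (n : ℝ) ^ 2) ∧
        |totalEnergy (deformedRing n ε w u)
            - ((riemannZeta 3).re / 4 + 1 / 24) * localEnergy (deformedRing n ε w u)|
          ≤ C * (ε ^ 3 + 1 / (n : ℝ) ^ 2) := by
  -- Enlarging K to max(K, 1) only weakens the hypotheses and meets the requirement 1 ≤ K.
  obtain ⟨C, ε₀, n₀, hε₀, h⟩ := exists_energy_bound (le_max_right K 1)
  refine ⟨2 * C, ε₀, n₀, hε₀, fun n ε w u hn hε hε1 hb hi => ?_⟩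
  have ht : 0 ≤ ε ^ 3 + 1 / (n : ℝ) ^ 2 := by positivity
  obtain ⟨h1, h2, h3, h4⟩ := h n ε w u hn hε hε1 (hb.mono (le_max_left K 1))
    fun j hj s => (hi j hj s).trans (by gcongr; exact le_max_left K 1)
  set E := localEnergy (deformedRing n ε w u)
  set N := nonlocalEnergy (deformedRing n ε w u) with hN
  have h0 := (abs_nonneg _).trans h3
  refine ⟨h1, h2, by linarith, ?_, by linarith, ?_⟩
  · have e : N - (π ^ 2 / 3 + ε ^ 2 * π / 6 * bendingForm w) = (N - 1 / 12 * E)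
        + 1 / 12 * (E - (4 * π ^ 2 + 2 * π * ε ^ 2 * bendingForm w)) := by ring
    rw [e]
    refine (abs_add_le _ _).trans ?_
    rw [abs_mul, abs_of_pos (by norm_num : (0 : ℝ) < 1 / 12)]
    linarith
  -- The ζ(3) terms cancel identically, leaving half of the nonlocal error.
  · have e : totalEnergy (deformedRing n ε w u) - ((riemannZeta 3).re / 4 + 1 / 24) * E
        = 1 / 2 * (N - 1 / 12 * E) := by
      rw [totalEnergy, ← hN]
      ring
    rw [e, abs_mul, abs_of_pos (by norm_num : (0 : ℝ) < 1 / 2)]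
    linarith
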